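/- Let $A$ be a commutative differential graded algebra over $\mathbb{Q}$, graded in non-negative cohomological degrees. $A$-modules are differential graded $A$-modules, graded over $\mathbb{Z}$. For $A$-modules $N,M$ let $[N,M]_A$ be the cochain complex whose degree-$k$ part consists of the $A$-linear maps $\lambda\colon N\to M[k]$ (with the Koszul sign rule), with differential $\lambda\mapsto d_M\lambda-(-1)^k\lambda d_N$. An $A$-module is cofibrant if it has the left lifting property with respect to all surjective quasi-isomorphisms of $A$-modules, and $\mathrm{Ext}_A^q(N,M)=H^q[N^c,M]_A$ for any quasi-isomorphism $N^c\to N$ with $N^c$ cofibrant. A minimal model of $N$ is a quasi-isomorphism of $A$-modules $A\otimes V\to N$, where the underlying graded $A$-module of the source is free on a graded rational vector space $V$ that has a homogeneous basis $\{v_\alpha\}_{\alpha\in\mathcal I}$ indexed by a well-ordered set such that $dv_\beta\in A\otimes\mathrm{span}\{v_\alpha\mid\alpha<\beta\}$ and $\alpha\le\beta\Rightarrow|v_\alpha|\le|v_\beta|$. Write $A\otimes V^{\le p}\subseteq A\otimes V$ for the $A$-submodule generated by the $v_\alpha$ with $|v_\alpha|\le p$, and $A\otimes V^{=p}$ for the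 quotient $(A\otimes V^{\le p})/(A\otimes V^{\le p-1})$. Let $N$ be an $A$-module whose cohomology is bounded below, with minimal model $A\otimes V\to N$, and let $M$ be an $A$-module whose cohomology is bounded above. The long exact cohomology sequences of the short exact sequences $$0\to[A\otimes V^{=p},M]_A\to[A\otimes V^{\le p},M]_A\to[A\otimes V^{\le p-1},M]_A\to0$$ form an exact couple with $D^{p,q}=H^q[A\otimes V^{\le p},M]_A$ and $E^{p,q}=H^q[A\otimes V^{=p},M]_A$. Then $A\otimes V$ is cofibrant, and the spectral sequence of this exact couple, with $d_r\colon E_r^{p,q}\to E_r^{p+r,q+1}$, converges strongly: $$E_1^{p,q}=H^q[A\otimes V^{=p},M]_A\Longrightarrow\mathrm{Ext}^q_A(N,M).$$ Explicitly, let $r\colon N^c\to N$ be any quasi-isomorphism with $N^c$ cofibrant. There is a morphism of $A$-modules $g\colon A\otimes V\to N^c$ whose composite with $r$ is homotopic to the minimal model map. For every such $g$, put $F^p\mathrm{Ext}^q_A(N,M)=\ker\big(H^q[N^c,M]_A\to H^q[A\otimes V^{\le p-1},M]_A\big)$, the map being induced by $g$. Then this decreasing filtration is exhaustive, Hausdorff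 and complete, and for all $p,q$ there is an isomorphism $F^p/F^{p+1}\cong E_\infty^{p,q}=Z_\infty^{p,q}/B_\infty^{p,q}$ under which the classes of $x\in F^p$ and $z\in Z_\infty^{p,q}$ correspond if and only if $x$ and $z$ have the same image in $D^{p,q}$. Here $Z_\infty^{p,q}=\bigcap_rZ_r^{p,q}$ and $B_\infty^{p,q}=\bigcup_rB_r^{p,q}$, where $Z_r^{p,q}\subseteq E^{p,q}$ is the preimage of the image of $D^{p+r-1,q}\to D^{p,q}$, $B_r^{p,q}$ is the image in $E^{p,q}$ of the kernel of $D^{p-1,q-1}\to D^{p-r,q-1}$ under the connecting map, and $E_r^{p,q}=Z_r^{p,q}/B_r^{p,q}$. -/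

import Mathlib

open CategoryTheory

universe u

/-- A commutative differential graded algebra over `ℚ`: graded in non-negative cohomological
degrees, graded commutative, with a differential of degree `1` that is a graded derivation. -/
structure CDGA : Type (u + 1) where
  carrier : Type u
  [ring : Ring carrier]
  [algebra : Algebra ℚ carrier]
  gr : ℤ → Submodule ℚ carrier
  [gradedAlgebra : GradedAlgebra gr]
  gr_neg : ∀ n < 0, gr n = ⊥
  mul_comm' : ∀ i j, ∀ a ∈ gr i, ∀ b ∈ gr j, a * b = (i * j).negOnePow • (b * a)
  d : carrier →ₗ[ℚ] carrier
  d_mem : ∀ i, ∀ a ∈ gr i, d a ∈ gr (i + 1)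
  d_d : ∀ a, d (d a) = 0
  leibniz : ∀ i, ∀ a ∈ gr i, ∀ b, d (a * b) = d a * b + i.negOnePow • (a * d b)

attribute [instance] CDGA.ring CDGA.algebra CDGA.gradedAlgebra

/-- A differential graded module over the cdga `A`, graded over `ℤ`. -/
structure DGMod (A : CDGA.{u}) : Type (u + 1) where
  carrier : Type u
  [addCommGroup : AddCommGroup carrier]
  [moduleRat : Module ℚ carrier]
  [module : Module A.carrier carrier]
  [isScalarTower : IsScalarTower ℚ A.carrier carrier]
  gr : ℤ → Submodule ℚ carrier
  isInternal : DirectSum.IsInternal gr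
  smul_mem : ∀ i j, ∀ a ∈ A.gr i, ∀ x ∈ gr j, a • x ∈ gr (i + j)
  d : carrier →ₗ[ℚ] carrier
  d_mem : ∀ i, ∀ x ∈ gr i, d x ∈ gr (i + 1)
  d_d : ∀ x, d (d x) = 0
  leibniz : ∀ i, ∀ a ∈ A.gr i, ∀ x, d (a • x) = A.d a • x + i.negOnePow • (a • d x)

attribute [instance] DGMod.addCommGroup DGMod.moduleRat DGMod.module DGMod.isScalarTower

namespace DGMod

variable {A : CDGA.{u}}

/-- A morphism of `A`-modules: `A`-linear, of degree zero and compatible with differentials. -/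
@[ext]
structure Hom (N M : DGMod A) where
  toLin : N.carrier →ₗ[A.carrier] M.carrier
  map_mem : ∀ n, ∀ x ∈ N.gr n, toLin x ∈ M.gr n
  map_d : ∀ x, toLin (N.d x) = M.d (toLin x)

/-- Composition `g ∘ f`. -/
def Hom.comp {L N M : DGMod A} (g : Hom N M) (f : Hom L N) : Hom L M where
  toLin := g.toLin ∘ₗ f.toLin
  map_mem n x hx := g.map_mem n _ (f.map_mem n x hx)
  map_d x := by simp [f.map_d, g.map_d]

/-- The cochain complex of rational vector spaces underlying an `A`-module. -/
def toComplex (M : DGMod A) : CochainComplex (ModuleCat.{u} ℚ) ℤ where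
  X n := ModuleCat.of ℚ (M.gr n)
  d i j :=
    if h : i + 1 = j then
      ModuleCat.ofHom (M.d.restrict (p := M.gr i) (q := M.gr j) fun x hx => h ▸ M.d_mem i x hx)
    else 0
  shape i j h := dif_neg h
  d_comp_d' i j k hij hjk := by
    have hij' : i + 1 = j := hij
    have hjk' : j + 1 = k := hjk
    rw [dif_pos hij', dif_pos hjk']
    ext x : 2
    exact Subtype.ext (M.d_d x.1)

/-- The map of underlying cochain complexes of a morphism of `A`-modules. -/
def Hom.toComplexHom {N M : DGMod A} (f : Hom N M) : N.toComplex ⟶ M.toComplex where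
  f n := ModuleCat.ofHom
    ((f.toLin.restrictScalars ℚ).restrict (p := N.gr n) (q := M.gr n) (f.map_mem n))
  comm' i j hij := by
    have hij' : i + 1 = j := hij
    dsimp only [toComplex]
    rw [dif_pos hij', dif_pos hij']
    ext x : 2
    exact Subtype.ext (f.map_d x.1).symm

/-- Weak equivalences of `A`-modules. -/
def Hom.IsQuasiIso {N M : DGMod A} (f : Hom N M) : Prop := _root_.QuasiIso f.toComplexHom

/-- The cohomology of `M` is bounded below. -/
def BoundedBelow (M : DGMod A) : Prop := ∃ k : ℤ, ∀ n < k, M.toComplex.ExactAt n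

/-- The cohomology of `M` is bounded above. -/
def BoundedAbove (M : DGMod A) : Prop := ∃ l : ℤ, ∀ n > l, M.toComplex.ExactAt n

/-- `P` is cofibrant in the projective model structure: it has the left lifting property with
respect to the surjective quasi-isomorphisms. -/
def Cofibrant (P : DGMod A) : Prop :=
  ∀ (X Y : DGMod A) (p : Hom X Y), Function.Surjective p.toLin → p.IsQuasiIso →
    ∀ f : Hom P Y, ∃ g : Hom P X, p.comp g = f

/-! ### Complexes of linear maps -/

/-- The space `[N, M]_A^k` of `A`-linear maps of degree `k`. In accordance with the Koszul sign
rule (that is, `a` acts on `M[k]` as `(-1) ^ (k |a|) a`), such a map satisfies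
`f (a x) = (-1) ^ (k |a|) a f x`. -/
def homDeg (N M : DGMod A) (k : ℤ) : Submodule ℚ (N.carrier →ₗ[ℚ] M.carrier) where
  carrier := {f | (∀ n, ∀ x ∈ N.gr n, f x ∈ M.gr (n + k)) ∧
    ∀ i, ∀ a ∈ A.gr i, ∀ x, f (a • x) = (k * i).negOnePow • (a • f x)}
  add_mem' {f g} hf hg := ⟨fun n x hx => add_mem (hf.1 n x hx) (hg.1 n x hx), fun i a ha x => by
    simp [hf.2 i a ha, hg.2 i a ha]⟩
  zero_mem' := ⟨fun n x _ => by simp, fun i a _ x => by simp⟩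
  smul_mem' c f hf := ⟨fun n x hx => Submodule.smul_mem _ c (hf.1 n x hx), fun i a ha x => by
    simp only [LinearMap.smul_apply, hf.2 i a ha, smul_comm c]⟩

/-- The differential `f ↦ d ∘ f - (-1) ^ k f ∘ d` of the complex of `A`-linear maps, on all
`ℚ`-linear maps. -/
def homD (N M : DGMod A) (k : ℤ) :
    (N.carrier →ₗ[ℚ] M.carrier) →ₗ[ℚ] (N.carrier →ₗ[ℚ] M.carrier) where
  toFun f := M.d ∘ₗ f - k.negOnePow • (f ∘ₗ N.d)
  map_add' f g := by
    ext x; simp; abel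
  map_smul' c f := by
    ext x; simp [smul_sub, smul_comm c]

theorem homD_apply (N M : DGMod A) (k : ℤ) (f : N.carrier →ₗ[ℚ] M.carrier) (x : N.carrier) :
    homD N M k f x = M.d (f x) - k.negOnePow • f (N.d x) := rfl

theorem negOnePow_smul_smul {X : Type*} [AddCommGroup X] (m n : ℤ) (x : X) :
    m.negOnePow • n.negOnePow • x = (m + n).negOnePow • x := by
  rw [Int.negOnePow_add, mul_smul]

theorem homD_mem (N M : DGMod A) (k l : ℤ) (h : k + 1 = l) (f : N.carrier →ₗ[ℚ] M.carrier)
    (hf : f ∈ homDeg N M k) : homD N M k f ∈ homDeg N M l := by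
  subst h
  refine ⟨fun n x hx => ?_, fun i a ha x => ?_⟩
  · have h1 := M.d_mem _ _ (hf.1 n x hx)
    have h2 := hf.1 _ _ (N.d_mem n x hx)
    rw [show n + 1 + k = n + (k + 1) by ring] at h2
    rw [show n + k + 1 = n + (k + 1) by ring] at h1
    rw [homD_apply]
    refine sub_mem h1 ?_
    rcases Int.units_eq_one_or k.negOnePow with h | h <;> rw [h]
    · simpa using h2
    · simpa using h2
  · rw [homD_apply, homD_apply, hf.2 i a ha, N.leibniz i a ha, map_add,
      hf.2 (i + 1) _ (A.d_mem i a ha)]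
    have e1 : M.d ((k * i).negOnePow • a • f x) = (k * i).negOnePow • M.d (a • f x) := by
      rcases Int.units_eq_one_or (k * i).negOnePow with h | h <;> rw [h] <;> simp
    have e2 : f (i.negOnePow • a • N.d x) = i.negOnePow • f (a • N.d x) := by
      rcases Int.units_eq_one_or i.negOnePow with h | h <;> rw [h] <;> simp
    have e3 : a • (M.d (f x) - k.negOnePow • f (N.d x)) =
        a • M.d (f x) - k.negOnePow • a • f (N.d x) := by
      rw [smul_sub]
      rcases Int.units_eq_one_or k.negOnePow with h | h <;> rw [h] <;> simp
    rw [e1, e2, e3, hf.2 i a ha, M.leibniz i a ha]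
    simp only [smul_add, smul_sub, negOnePow_smul_smul]
    have s1 : (k + k * (i + 1)).negOnePow = (k * i).negOnePow := by
      rw [show k + k * (i + 1) = k * i + (k + k) by ring, Int.negOnePow_add _ (k + k),
        Int.negOnePow_even _ ⟨k, rfl⟩, mul_one]
    rw [s1, show (k + 1) * i = k * i + i by ring,
      show k + (i + k * i) = k * i + i + k by ring]
    abel

theorem homD_homD (N M : DGMod A) (k : ℤ) (f : N.carrier →ₗ[ℚ] M.carrier) :
    homD N M (k + 1) (homD N M k f) = 0 := by
  ext x
  simp only [homD_apply, map_sub, N.d_d, M.d_d, map_zero, smul_zero, sub_zero, zero_sub,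
    LinearMap.zero_apply, Int.negOnePow_succ]
  rcases Int.units_eq_one_or k.negOnePow with h | h <;> rw [h] <;> simp

/-- The cochain complex `[N, M]_A` of `A`-linear maps. -/
def homComplex (N M : DGMod A) : CochainComplex (ModuleCat.{u} ℚ) ℤ where
  X k := ModuleCat.of ℚ (homDeg N M k)
  d k l :=
    if h : k + 1 = l then
      ModuleCat.ofHom ((homD N M k).restrict (p := homDeg N M k) (q := homDeg N M l)
        (homD_mem N M k l h))
    else 0
  shape k l h := dif_neg h
  d_comp_d' i j k hij hjk := by
    have hij' : i + 1 = j := hij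
    have hjk' : j + 1 = k := hjk
    subst hij' hjk'
    rw [dif_pos rfl, dif_pos rfl]
    ext x : 2
    exact Subtype.ext (homD_homD N M i x.1)

theorem comp_mem_homDeg {N' N : DGMod A} (g : N'.carrier →ₗ[A.carrier] N.carrier)
    (hg : ∀ n, ∀ x ∈ N'.gr n, g x ∈ N.gr n) (M : DGMod A) (k : ℤ)
    (f : N.carrier →ₗ[ℚ] M.carrier) (hf : f ∈ homDeg N M k) :
    f ∘ₗ g.restrictScalars ℚ ∈ homDeg N' M k :=
  ⟨fun n x hx => hf.1 n _ (hg n x hx), fun i a ha x => by simp [hf.2 i a ha]⟩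

/-- Precomposition with a morphism `g : N' ⟶ N`, as a map `[N, M]_A ⟶ [N', M]_A`. -/
def homComplexMap {N' N : DGMod A} (g : Hom N' N) (M : DGMod A) :
    homComplex N M ⟶ homComplex N' M where
  f k := ModuleCat.ofHom ((LinearMap.lcomp ℚ M.carrier (g.toLin.restrictScalars ℚ)).restrict
    (p := homDeg N M k) (q := homDeg N' M k) (comp_mem_homDeg g.toLin g.map_mem M k))
  comm' i j hij := by
    have hij' : i + 1 = j := hij
    dsimp only [homComplex]
    rw [dif_pos hij', dif_pos hij']
    ext f : 2
    refine Subtype.ext (LinearMap.ext fun x => ?_)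
    change M.d (f.1 (g.toLin x)) - i.negOnePow • f.1 (g.toLin (N'.d x)) =
      M.d (f.1 (g.toLin x)) - i.negOnePow • f.1 (N.d (g.toLin x))
    rw [g.map_d]

/-- Two morphisms are homotopic if they differ by the boundary of an `A`-linear map of
degree `-1`. -/
def Hom.Homotopic {N M : DGMod A} (f g : Hom N M) : Prop :=
  ∃ h ∈ homDeg N M (-1), ∀ x, f.toLin x - g.toLin x = M.d (h x) + h (N.d x)

/-- A cofibrant replacement `obj → N`: a quasi-isomorphism from a cofibrant `A`-module. -/
structure CofibrantReplacement (N : DGMod A) where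
  obj : DGMod A
  map : Hom obj N
  cofibrant : obj.Cofibrant
  isQuasiIso : map.IsQuasiIso

/-- `Ext_A^q(N, M)`, computed by the cofibrant replacement `R` of `N`. -/
noncomputable def CofibrantReplacement.Ext {N : DGMod A} (R : CofibrantReplacement N)
    (M : DGMod A) (q : ℤ) : ModuleCat.{u} ℚ :=
  (homComplex R.obj M).homology q

end DGMod

/-! ### Submodules and quotients -/

namespace DGMod

variable {A : CDGA.{u}}

/-- The projection onto the homogeneous component of degree `n`. -/
noncomputable def proj (M : DGMod A) (n : ℤ) : M.carrier →ₗ[ℚ] M.carrier :=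
  letI := M.isInternal.chooseDecomposition
  (M.gr n).subtype ∘ₗ DirectSum.component ℚ ℤ (fun i => M.gr i) n ∘ₗ
    (DirectSum.decomposeLinearEquiv M.gr).toLinearMap

theorem proj_mem (M : DGMod A) (n : ℤ) (x : M.carrier) : M.proj n x ∈ M.gr n :=
  Subtype.mem _

theorem proj_same (M : DGMod A) {n : ℤ} {x : M.carrier} (hx : x ∈ M.gr n) : M.proj n x = x :=
  letI := M.isInternal.chooseDecomposition
  DirectSum.decompose_of_mem_same M.gr hx

theorem proj_ne (M : DGMod A) {m n : ℤ} {x : M.carrier} (hx : x ∈ M.gr m) (h : m ≠ n) :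
    M.proj n x = 0 :=
  letI := M.isInternal.chooseDecomposition
  DirectSum.decompose_of_mem_ne M.gr hx h

theorem proj_sum (M : DGMod A) (x : M.carrier) : ∃ s : Finset ℤ, x = ∑ n ∈ s, M.proj n x := by
  classical
  let := M.isInternal.chooseDecomposition
  exact ⟨_, (DirectSum.sum_support_decompose M.gr x).symm⟩

theorem induction (M : DGMod A) {motive : M.carrier → Prop} (zero : motive 0)
    (mem : ∀ n, ∀ x ∈ M.gr n, motive x) (add : ∀ x y, motive x → motive y → motive (x + y))
    (x : M.carrier) : motive x := by
  obtain ⟨s, hs⟩ := M.proj_sum x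
  rw [hs]
  exact Finset.sum_induction _ motive add zero fun n _ => mem n _ (M.proj_mem n x)

theorem alg_induction {motive : A.carrier → Prop} (zero : motive 0)
    (mem : ∀ n, ∀ a ∈ A.gr n, motive a) (add : ∀ x y, motive x → motive y → motive (x + y))
    (a : A.carrier) : motive a :=
  DirectSum.Decomposition.inductionOn A.gr zero (fun {n} m => mem n m.1 m.2) add a

theorem proj_smul (M : DGMod A) {i : ℤ} {a : A.carrier} (ha : a ∈ A.gr i) (n : ℤ)
    (x : M.carrier) : M.proj (i + n) (a • x) = a • M.proj n x := by
  induction x using M.induction with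
  | zero => simp
  | mem m x hx =>
    by_cases h : m = n
    · subst h
      rw [M.proj_same hx, M.proj_same (M.smul_mem _ _ a ha x hx)]
    · rw [M.proj_ne hx h, M.proj_ne (M.smul_mem _ _ a ha x hx) (by lia), smul_zero]
  | add x y hx hy => rw [smul_add, map_add, map_add, hx, hy, smul_add]

theorem proj_map {N M : DGMod A} (f : N.carrier →ₗ[A.carrier] M.carrier)
    (hf : ∀ n, ∀ x ∈ N.gr n, f x ∈ M.gr n) (n : ℤ) (x : N.carrier) :
    f (N.proj n x) = M.proj n (f x) := by
  induction x using N.induction with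
  | zero => simp
  | mem m x hx =>
    by_cases h : m = n
    · subst h
      rw [N.proj_same hx, M.proj_same (hf _ x hx)]
    · rw [N.proj_ne hx h, M.proj_ne (hf _ x hx) h, map_zero]
  | add x y hx hy => simp only [map_add, hx, hy]

/-- A submodule is homogeneous if it contains the homogeneous components of its elements. -/
def IsHomogeneous (M : DGMod A) (S : Submodule A.carrier M.carrier) : Prop :=
  ∀ x ∈ S, ∀ n, M.proj n x ∈ S

theorem isInternal_of_proj {X : Type u} [AddCommGroup X] [Module ℚ X] (gr : ℤ → Submodule ℚ X)
    (P : ℤ → X →ₗ[ℚ] X) (h1 : ∀ n, ∀ x ∈ gr n, P n x = x)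
    (h2 : ∀ m n, m ≠ n → ∀ x ∈ gr m, P n x = 0) (h3 : ∀ x, ∃ s : Finset ℤ, ∃ y : ℤ → X,
      (∀ n, y n ∈ gr n) ∧ x = ∑ n ∈ s, y n) : DirectSum.IsInternal gr := by
  refine DirectSum.isInternal_submodule_of_iSupIndep_of_iSup_eq_top ?_ ?_
  · rw [iSupIndep_iff_finsetSum_eq_zero_imp_eq_zero]
    intro s v hv hs n hn
    have h := congrArg (P n) hs
    rw [map_sum, map_zero, Finset.sum_eq_single n (fun m hm hmn => h2 m n hmn _ (hv m hm))
      (fun h => absurd hn h), h1 n _ (hv n hn)] at h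
    exact h
  · rw [eq_top_iff]
    intro x _
    obtain ⟨s, y, hy, rfl⟩ := h3 x
    exact sum_mem fun n _ => Submodule.mem_iSup_of_mem n (hy n)

/-- The differential graded submodule of `M` on a homogeneous submodule that is stable under the
differential. -/
def sub (M : DGMod A) (S : Submodule A.carrier M.carrier) (hS : M.IsHomogeneous S)
    (hd : ∀ x ∈ S, M.d x ∈ S) : DGMod A where
  carrier := S
  gr n := (M.gr n).comap (S.subtype.restrictScalars ℚ)
  isInternal := isInternal_of_proj _
    (fun n => (M.proj n).restrict (p := S.restrictScalars ℚ) (q := S.restrictScalars ℚ)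
      fun x hx => hS x hx n)
    (fun n x hx => Subtype.ext (M.proj_same hx))
    (fun m n h x hx => Subtype.ext (M.proj_ne hx h))
    (fun x => by
      obtain ⟨s, hs⟩ := M.proj_sum x.1
      refine ⟨s, fun n => ⟨M.proj n x.1, hS _ x.2 n⟩, fun n => M.proj_mem n x.1, ?_⟩
      apply Subtype.ext
      rw [AddSubmonoidClass.coe_finsetSum]
      exact hs)
  smul_mem i j a ha x hx := M.smul_mem i j a ha x.1 hx
  d := M.d.restrict (p := S.restrictScalars ℚ) (q := S.restrictScalars ℚ) hd
  d_mem i x hx := M.d_mem i x.1 hx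
  d_d x := Subtype.ext (M.d_d x.1)
  leibniz i a ha x := by
    apply Subtype.ext
    have := M.leibniz i a ha x.1
    rcases Int.units_eq_one_or i.negOnePow with h | h <;> rw [h] at this ⊢ <;> simpa using! this

/-- The quotient of `M` by a homogeneous submodule that is stable under the differential. -/
def quot (M : DGMod A) (S : Submodule A.carrier M.carrier) (hS : M.IsHomogeneous S)
    (hd : ∀ x ∈ S, M.d x ∈ S) : DGMod A where
  carrier := M.carrier ⧸ S
  gr n := (M.gr n).map (S.mkQ.restrictScalars ℚ)
  isInternal := isInternal_of_proj _
    (fun n => (S.restrictScalars ℚ).mapQ (S.restrictScalars ℚ) (M.proj n) fun x hx => hS x hx n)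
    (by
      rintro n _ ⟨x, hx, rfl⟩
      exact congrArg S.mkQ (M.proj_same hx))
    (by
      rintro m n h _ ⟨x, hx, rfl⟩
      exact congrArg S.mkQ (M.proj_ne hx h))
    (fun x => by
      obtain ⟨x, rfl⟩ := S.mkQ_surjective x
      obtain ⟨s, hs⟩ := M.proj_sum x
      refine ⟨s, fun n => S.mkQ (M.proj n x), fun n => ⟨_, M.proj_mem n x, rfl⟩, ?_⟩
      rw [← map_sum, ← hs])
  smul_mem := by
    rintro i j a ha _ ⟨x, hx, rfl⟩
    exact ⟨a • x, M.smul_mem i j a ha x hx, rfl⟩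
  d := (S.restrictScalars ℚ).mapQ (S.restrictScalars ℚ) M.d hd
  d_mem := by
    rintro i _ ⟨x, hx, rfl⟩
    exact ⟨M.d x, M.d_mem i x hx, rfl⟩
  d_d x := by
    obtain ⟨x, rfl⟩ := S.mkQ_surjective x
    exact congrArg S.mkQ (M.d_d x)
  leibniz i a ha x := by
    obtain ⟨x, rfl⟩ := S.mkQ_surjective x
    have := congrArg S.mkQ (M.leibniz i a ha x)
    rcases Int.units_eq_one_or i.negOnePow with h | h <;> rw [h] at this ⊢ <;> simpa using! this

/-- The inclusion of a submodule into `M`. -/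
def subι (M : DGMod A) (S : Submodule A.carrier M.carrier) (hS : M.IsHomogeneous S)
    (hd : ∀ x ∈ S, M.d x ∈ S) : Hom (M.sub S hS hd) M where
  toLin := S.subtype
  map_mem _ _ hx := hx
  map_d _ := rfl

/-- The inclusion between submodules. -/
def subLE (M : DGMod A) {S T : Submodule A.carrier M.carrier} (h : S ≤ T)
    (hS : M.IsHomogeneous S) (hSd : ∀ x ∈ S, M.d x ∈ S)
    (hT : M.IsHomogeneous T) (hTd : ∀ x ∈ T, M.d x ∈ T) :
    Hom (M.sub S hS hSd) (M.sub T hT hTd) where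
  toLin := Submodule.inclusion h
  map_mem _ _ hx := hx
  map_d _ := rfl

/-- The projection of `M` onto a quotient. -/
def quotπ (M : DGMod A) (S : Submodule A.carrier M.carrier) (hS : M.IsHomogeneous S)
    (hd : ∀ x ∈ S, M.d x ∈ S) : Hom M (M.quot S hS hd) where
  toLin := S.mkQ
  map_mem _ x hx := ⟨x, hx, rfl⟩
  map_d _ := rfl

theorem isHomogeneous_span (M : DGMod A) (T : Set M.carrier) (hT : ∀ v ∈ T, ∃ n, v ∈ M.gr n) :
    M.IsHomogeneous (Submodule.span A.carrier T) := by
  intro x hx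
  induction hx using Submodule.span_induction with
  | mem v hv =>
    intro n
    obtain ⟨m, hm⟩ := hT v hv
    by_cases h : m = n
    · subst h
      rw [M.proj_same hm]
      exact Submodule.subset_span hv
    · rw [M.proj_ne hm h]
      exact zero_mem _
  | zero => intro n; rw [map_zero]; exact zero_mem _
  | add x y _ _ hx hy => intro n; rw [map_add]; exact add_mem (hx n) (hy n)
  | smul a x _ hx =>
    intro n
    induction a using alg_induction with
    | zero => simp
    | mem i a ha =>
      have := M.proj_smul ha (n - i) x
      rw [show i + (n - i) = n by ring] at this
      rw [this]
      exact Submodule.smul_mem _ a (hx _)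
    | add a b ha hb => rw [add_smul, map_add]; exact add_mem ha hb

theorem d_mem_span (M : DGMod A) (T : Set M.carrier)
    (hT : ∀ v ∈ T, M.d v ∈ Submodule.span A.carrier T) :
    ∀ x ∈ Submodule.span A.carrier T, M.d x ∈ Submodule.span A.carrier T := by
  intro x hx
  induction hx using Submodule.span_induction with
  | mem v hv => exact hT v hv
  | zero => simp
  | add x y _ _ hx hy => rw [map_add]; exact add_mem hx hy
  | smul a x hx' hx =>
    induction a using alg_induction with
    | zero => simp
    | mem i a ha =>
      rw [M.leibniz i a ha]
      refine add_mem (Submodule.smul_mem _ _ hx') ?_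
      have := Submodule.smul_mem _ a hx
      rcases Int.units_eq_one_or i.negOnePow with h | h <;> rw [h]
      · simpa using this
      · simpa using this
    | add a b ha hb => rw [add_smul, map_add]; exact add_mem ha hb

/-! ### Minimal modules -/

/-- A presentation of `L` as a minimal `A`-module `A ⊗ V`: the elements `v α` form a homogeneous
basis of the graded `A`-module `L` (so `V` is their rational span) indexed by a well-ordered set,
`d (v β)` lies in the `A`-submodule `A ⊗ V_{<β}` generated by the `v α` with `α < β`, and the
degree of `v α` is weakly increasing in `α`. -/
structure MinimalBasis (L : DGMod A) where
  ι : Type u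
  [linearOrder : LinearOrder ι]
  [wellFoundedLT : WellFoundedLT ι]
  v : Module.Basis ι A.carrier L.carrier
  deg : ι → ℤ
  v_mem : ∀ α, v α ∈ L.gr (deg α)
  d_v_mem : ∀ β, L.d (v β) ∈ Submodule.span A.carrier (v '' Set.Iio β)
  deg_mono : Monotone deg

attribute [instance] MinimalBasis.linearOrder MinimalBasis.wellFoundedLT

namespace MinimalBasis

variable {L : DGMod A} (V : L.MinimalBasis)

/-- The submodule `A ⊗ V^{≤ p}`. -/
def leSubmodule (p : ℤ) : Submodule A.carrier L.carrier :=
  Submodule.span A.carrier (V.v '' {α | V.deg α ≤ p})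

theorem leSubmodule_mono {p p' : ℤ} (h : p' ≤ p) : V.leSubmodule p' ≤ V.leSubmodule p :=
  Submodule.span_mono (Set.image_mono fun _ hα => le_trans hα h)

theorem leSubmodule_isHomogeneous (p : ℤ) : L.IsHomogeneous (V.leSubmodule p) := by
  refine L.isHomogeneous_span _ ?_
  rintro _ ⟨α, _, rfl⟩
  exact ⟨_, V.v_mem α⟩

theorem d_mem_leSubmodule (p : ℤ) : ∀ x ∈ V.leSubmodule p, L.d x ∈ V.leSubmodule p := by
  refine L.d_mem_span _ ?_
  rintro _ ⟨β, hβ, rfl⟩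
  exact Submodule.span_mono (Set.image_mono fun α hα =>
    le_trans (V.deg_mono (le_of_lt hα)) hβ) (V.d_v_mem β)

/-- The `A`-module `A ⊗ V^{≤ p}`. -/
def le (p : ℤ) : DGMod A :=
  L.sub (V.leSubmodule p) (V.leSubmodule_isHomogeneous p) (V.d_mem_leSubmodule p)

/-- The inclusion of `A ⊗ V^{≤ p}` into `A ⊗ V`. -/
def leι (p : ℤ) : Hom (V.le p) L := L.subι _ _ _

/-- The inclusion of `A ⊗ V^{≤ p'}` into `A ⊗ V^{≤ p}`. -/
def leLE {p p' : ℤ} (h : p' ≤ p) : Hom (V.le p') (V.le p) :=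
  L.subLE (V.leSubmodule_mono h) _ _ _ _

/-- The submodule `A ⊗ V^{≤ p - 1}` of `A ⊗ V^{≤ p}`. -/
def predSubmodule (p : ℤ) : Submodule A.carrier (V.le p).carrier :=
  (V.leSubmodule (p - 1)).comap (V.leSubmodule p).subtype

theorem predSubmodule_isHomogeneous (p : ℤ) : (V.le p).IsHomogeneous (V.predSubmodule p) := by
  intro x hx n
  change (V.leι p).toLin ((V.le p).proj n x) ∈ V.leSubmodule (p - 1)
  rw [proj_map _ (V.leι p).map_mem]
  exact V.leSubmodule_isHomogeneous (p - 1) _ hx n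

theorem d_mem_predSubmodule (p : ℤ) : ∀ x ∈ V.predSubmodule p, (V.le p).d x ∈ V.predSubmodule p :=
  fun x hx => V.d_mem_leSubmodule (p - 1) x.1 hx

/-- The `A`-module `A ⊗ V^{= p}`, the cofibre (quotient) of `A ⊗ V^{≤ p - 1} → A ⊗ V^{≤ p}`. -/
def slice (p : ℤ) : DGMod A :=
  (V.le p).quot (V.predSubmodule p) (V.predSubmodule_isHomogeneous p) (V.d_mem_predSubmodule p)

/-- The projection of `A ⊗ V^{≤ p}` onto `A ⊗ V^{= p}`. -/
def sliceπ (p : ℤ) : Hom (V.le p) (V.slice p) := (V.le p).quotπ _ _ _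

/-- The sequence `[A ⊗ V^{= p}, M]_A ⟶ [A ⊗ V^{≤ p}, M]_A ⟶ [A ⊗ V^{≤ p - 1}, M]_A`. -/
def sliceSequence (M : DGMod A) (p : ℤ) : ShortComplex (CochainComplex (ModuleCat.{u} ℚ) ℤ) where
  X₁ := homComplex (V.slice p) M
  X₂ := homComplex (V.le p) M
  X₃ := homComplex (V.le (p - 1)) M
  f := homComplexMap (V.sliceπ p) M
  g := homComplexMap (V.leLE (sub_le_self p zero_le_one)) M
  zero := by
    ext k f : 3
    refine Subtype.ext (LinearMap.ext fun x => ?_)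
    change f.1 ((V.predSubmodule p).mkQ _) = 0
    have : (V.predSubmodule p).mkQ ((V.leLE (sub_le_self p zero_le_one)).toLin x) = 0 :=
      (Submodule.Quotient.mk_eq_zero _).2 x.2
    exact (congrArg f.1 this).trans (map_zero f.1)

open Classical in
/-- The `A`-linear retraction of `A ⊗ V` onto `A ⊗ V^{≤ p}` that kills the other basis elements. -/
noncomputable def retr (p : ℤ) : L.carrier →ₗ[A.carrier] L.carrier :=
  V.v.constr ℕ fun α => if V.deg α ≤ p then V.v α else 0

theorem retr_v (p : ℤ) (α : V.ι) [Decidable (V.deg α ≤ p)] :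
    V.retr p (V.v α) = if V.deg α ≤ p then V.v α else 0 := by
  rw [retr, Module.Basis.constr_basis]
  congr

theorem retr_mem (p : ℤ) (x : L.carrier) : V.retr p x ∈ V.leSubmodule p := by
  classical
  have hx : x ∈ (⊤ : Submodule A.carrier L.carrier) := trivial
  rw [← V.v.span_eq] at hx
  induction hx using Submodule.span_induction with
  | zero => simp
  | add x y _ _ hx hy => rw [map_add]; exact add_mem hx hy
  | smul a x _ hx => rw [map_smul]; exact Submodule.smul_mem _ a hx
  | mem x hx =>
    obtain ⟨α, rfl⟩ := hx
    rw [retr_v]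
    split_ifs with h
    · exact Submodule.subset_span ⟨α, h, rfl⟩
    · exact zero_mem _

theorem retr_of_mem (p : ℤ) (x : L.carrier) (hx : x ∈ V.leSubmodule p) : V.retr p x = x := by
  classical
  induction hx using Submodule.span_induction with
  | mem x hx =>
    obtain ⟨α, hα, rfl⟩ := hx
    rw [retr_v]
    exact if_pos hα
  | zero => simp
  | add x y _ _ hx hy => rw [map_add, hx, hy]
  | smul a x _ hx => rw [map_smul, hx]

theorem proj_retr (p n : ℤ) (x : L.carrier) : L.proj n (V.retr p x) = V.retr p (L.proj n x) := by
  classical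
  have hx : x ∈ (⊤ : Submodule A.carrier L.carrier) := trivial
  rw [← V.v.span_eq] at hx
  induction hx using Submodule.span_induction generalizing n with
  | mem x hx =>
    obtain ⟨α, rfl⟩ := hx
    rw [retr_v]
    by_cases hn : V.deg α = n
    · subst hn
      rw [L.proj_same (V.v_mem α), retr_v]
      split_ifs with h
      · exact L.proj_same (V.v_mem α)
      · exact map_zero _
    · rw [L.proj_ne (V.v_mem α) hn, map_zero]
      split_ifs with h
      · exact L.proj_ne (V.v_mem α) hn
      · exact map_zero _
  | zero => simp
  | add x y _ _ hx hy => simp only [map_add, hx, hy]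
  | smul a x _ hx =>
    induction a using alg_induction with
    | zero => simp
    | mem i a ha =>
      have h1 := L.proj_smul ha (n - i) x
      have h2 := L.proj_smul ha (n - i) (V.retr p x)
      rw [show i + (n - i) = n by ring] at h1 h2
      rw [h1, (V.retr p).map_smul, (V.retr p).map_smul, h2, hx]
    | add a b ha hb => rw [add_smul, map_add, map_add, map_add, map_add, ha, hb]

/-- The retraction as a map of graded modules `A ⊗ V^{≤ p} → A ⊗ V^{≤ p - 1}`. -/
noncomputable def predRetr (p : ℤ) : (V.le p).carrier →ₗ[A.carrier] (V.le (p - 1)).carrier :=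
  (V.retr (p - 1)).codRestrict (V.leSubmodule (p - 1)) (V.retr_mem (p - 1)) ∘ₗ
    (V.leSubmodule p).subtype

theorem predRetr_mem (p n : ℤ) (x : (V.le p).carrier) (hx : x ∈ (V.le p).gr n) :
    V.predRetr p x ∈ (V.le (p - 1)).gr n := by
  change V.retr (p - 1) x.1 ∈ L.gr n
  have h : x.1 ∈ L.gr n := hx
  rw [← L.proj_same h, ← proj_retr]
  exact L.proj_mem _ _

theorem sliceSequence_shortExact (M : DGMod A) (p : ℤ) : (V.sliceSequence M p).ShortExact := by
  refine HomologicalComplex.shortExact_of_degreewise_shortExact _ fun k =>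
    ModuleCat.shortComplex_shortExact _ ?_ ?_ ?_
  · intro f
    constructor
    · intro hf
      have hf' : ∀ x : (V.le p).carrier, x.1 ∈ V.leSubmodule (p - 1) → f.1 x = 0 := by
        intro x hx
        have := congrArg Subtype.val hf
        exact LinearMap.congr_fun this (⟨x.1, hx⟩ : V.leSubmodule (p - 1))
      refine ⟨⟨((V.predSubmodule p).restrictScalars ℚ).liftQ f.1 fun x hx => hf' x hx, ?_, ?_⟩, ?_⟩
      · rintro n _ ⟨x, hx, rfl⟩
        exact f.2.1 n x hx
      · intro i a ha x
        obtain ⟨x, rfl⟩ := (V.predSubmodule p).mkQ_surjective x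
        exact f.2.2 i a ha x
      · exact Subtype.ext (LinearMap.ext fun x => rfl)
    · rintro ⟨g, rfl⟩
      exact congrArg (fun φ => (φ.f k).hom g) (V.sliceSequence M p).zero
  · intro f g hfg
    refine Subtype.ext (LinearMap.ext fun x => ?_)
    obtain ⟨x, rfl⟩ := (V.predSubmodule p).mkQ_surjective x
    exact LinearMap.congr_fun (congrArg Subtype.val hfg) x
  · intro f
    refine ⟨⟨f.1 ∘ₗ (V.predRetr p).restrictScalars ℚ,
      comp_mem_homDeg _ (V.predRetr_mem p) M k f.1 f.2⟩, ?_⟩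
    refine Subtype.ext (LinearMap.ext fun x => ?_)
    change f.1 (V.predRetr p ((V.leLE (sub_le_self p zero_le_one)).toLin x)) = f.1 x
    congr 1
    exact Subtype.ext (V.retr_of_mem (p - 1) x.1 x.2)

end MinimalBasis
end DGMod

/-! ### Exact couples and their spectral sequences -/

/-- A bigraded exact couple of rational vector spaces, arising from an inverse system
`⋯ ⟶ D p ⟶ D (p - 1) ⟶ ⋯` of graded vector spaces. The maps `i h q` are the transition maps of the
inverse system, `j` has degree `1` in the second grading and `k` has degree `0`. -/
structure ExactCouple : Type (u + 1) where
  D : ℤ → ℤ → ModuleCat.{u} ℚ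
  E : ℤ → ℤ → ModuleCat.{u} ℚ
  i : ∀ {p p' : ℤ}, p' ≤ p → ∀ q, D p q →ₗ[ℚ] D p' q
  i_self : ∀ p q x, i (le_refl p) q x = x
  i_i : ∀ {p p' p'' : ℤ} (h : p' ≤ p) (h' : p'' ≤ p') q x, i h' q (i h q x) = i (h'.trans h) q x
  j : ∀ (p : ℤ) {q q' : ℤ}, q + 1 = q' → D (p - 1) q →ₗ[ℚ] E p q'
  k : ∀ p q, E p q →ₗ[ℚ] D p q
  exact_k_i : ∀ p q, Function.Exact (k p q) (i (sub_le_self p zero_le_one) q)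
  exact_i_j : ∀ p {q q'} (h : q + 1 = q'),
    Function.Exact (i (sub_le_self p zero_le_one) q) (j p h)
  exact_j_k : ∀ p {q q'} (h : q + 1 = q'), Function.Exact (j p h) (k p q')

namespace ExactCouple

variable (C : ExactCouple.{u})

/-- The `r`-cycles `Z_r^{p,q} = k⁻¹ (im (D^{p+r-1,q} → D^{p,q}))`, for `r ≥ 1`. -/
def Z (r : ℤ) (hr : 1 ≤ r) (p q : ℤ) : Submodule ℚ (C.E p q) :=
  (LinearMap.range (C.i (show p ≤ p + r - 1 by lia) q)).comap (C.k p q)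

/-- The `r`-boundaries `B_r^{p,q} = j (ker (D^{p-1,q-1} → D^{p-r,q-1}))`, for `r ≥ 1`. -/
def B (r : ℤ) (hr : 1 ≤ r) (p q : ℤ) : Submodule ℚ (C.E p q) :=
  (LinearMap.ker (C.i (show p - r ≤ p - 1 by lia) (q - 1))).map (C.j p (sub_add_cancel q 1))

/-- The entry `E_r^{p,q} = Z_r^{p,q} / B_r^{p,q}` of the `r`-th page. -/
abbrev page (r : ℤ) (hr : 1 ≤ r) (p q : ℤ) : Type u :=
  C.Z r hr p q ⧸ (C.B r hr p q).submoduleOf (C.Z r hr p q)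

/-- The infinite cycles, the intersection of the `Z_r`. -/
def Zinfty (p q : ℤ) : Submodule ℚ (C.E p q) := ⨅ (r : ℤ) (hr : 1 ≤ r), C.Z r hr p q

/-- The infinite boundaries, the union of the `B_r`. -/
def Binfty (p q : ℤ) : Submodule ℚ (C.E p q) := ⨆ (r : ℤ) (hr : 1 ≤ r), C.B r hr p q

/-- The entry `E_∞^{p,q}` of the limit page. -/
abbrev pageInfty (p q : ℤ) : Type u :=
  C.Zinfty p q ⧸ (C.Binfty p q).submoduleOf (C.Zinfty p q)

variable {C}

theorem mem_Z {r : ℤ} {hr : 1 ≤ r} {p p' q : ℤ} (hp : p + r = p') {x : C.E p q} :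
    x ∈ C.Z r hr p q ↔ ∃ y, C.i (show p ≤ p' - 1 by lia) q y = C.k p q x := by
  subst hp
  rfl

theorem mem_B {r : ℤ} {hr : 1 ≤ r} {p p' q q' : ℤ} (hp : p' + r = p) (hq : q' + 1 = q)
    {x : C.E p q} :
    x ∈ C.B r hr p q ↔ ∃ y, C.i (show p' ≤ p - 1 by lia) q' y = 0 ∧ C.j p hq y = x := by
  obtain rfl : p' = p - r := by lia
  obtain rfl : q' = q - 1 := by lia
  rfl

theorem k_j (p : ℤ) {q q' : ℤ} (h : q + 1 = q') (y : C.D (p - 1) q) :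
    C.k p q' (C.j p h y) = 0 := (C.exact_j_k p h).apply_apply_eq_zero y

theorem j_mem_Z (r : ℤ) (hr : 1 ≤ r) (p : ℤ) {q q' : ℤ} (h : q + 1 = q') (y : C.D (p - 1) q) :
    C.j p h y ∈ C.Z r hr p q' :=
  (mem_Z rfl).2 ⟨0, by rw [k_j, map_zero]⟩

theorem k_of_mem_B {r : ℤ} {hr : 1 ≤ r} {p q : ℤ} {x : C.E p q} (hx : x ∈ C.B r hr p q) :
    C.k p q x = 0 := by
  obtain ⟨y, -, rfl⟩ := (mem_B (sub_add_cancel p r) (sub_add_cancel q 1)).1 hx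
  exact k_j _ _ _

theorem Z_one (p q : ℤ) : C.Z 1 le_rfl p q = ⊤ := by
  rw [eq_top_iff]
  intro x _
  have : ∀ p' (h : p ≤ p'), p' = p → ∃ y, C.i h q y = C.k p q x := by
    rintro _ h rfl
    exact ⟨_, C.i_self _ _ _⟩
  exact this _ _ (by lia)

theorem B_one (p q : ℤ) : C.B 1 le_rfl p q = ⊥ := by
  rw [eq_bot_iff]
  intro x hx
  obtain ⟨y, hy, rfl⟩ := (mem_B (sub_add_cancel p 1) (sub_add_cancel q 1)).1 hx
  rw [C.i_self] at hy
  rw [hy, map_zero]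
  exact zero_mem _

section differential

variable {r : ℤ} {hr : 1 ≤ r} {p p' q q' : ℤ}

/-- A lift of `k x` to `D^{p+r-1}`, for `x` in `Z_r`. -/
noncomputable def lift (hp : p + r = p') (x : C.Z r hr p q) : C.D (p' - 1) q :=
  ((mem_Z hp).1 x.2).choose

theorem i_lift (hp : p + r = p') (x : C.Z r hr p q) :
    C.i (show p ≤ p' - 1 by lia) q (lift hp x) = C.k p q x.1 :=
  ((mem_Z hp).1 x.2).choose_spec

theorem mk_j_eq (hp : p + r = p') (hq : q + 1 = q') (y y' : C.D (p' - 1) q)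
    (h : C.i (show p ≤ p' - 1 by lia) q y = C.i (show p ≤ p' - 1 by lia) q y') :
    ((C.B r hr p' q').submoduleOf (C.Z r hr p' q')).mkQ ⟨C.j p' hq y, j_mem_Z r hr p' hq y⟩ =
      ((C.B r hr p' q').submoduleOf (C.Z r hr p' q')).mkQ
        ⟨C.j p' hq y', j_mem_Z r hr p' hq y'⟩ := by
  refine (Submodule.Quotient.eq _).2 ?_
  refine (mem_B (hr := hr) hp hq).2 ⟨y - y', by rw [map_sub, h, sub_self], ?_⟩
  simp

variable (C r hr) in
/-- The differential `d_r : E_r^{p,q} → E_r^{p+r,q+1}`; it sends the class of `x` to the class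
of `j y` for any `y` in `D^{p+r-1,q}` that maps to `k x`. -/
noncomputable def dPage (hp : p + r = p') (hq : q + 1 = q') :
    C.page r hr p q →ₗ[ℚ] C.page r hr p' q' :=
  Submodule.liftQ _
    { toFun := fun x => Submodule.mkQ _
        (⟨C.j p' hq (lift hp x), j_mem_Z r hr p' hq _⟩ : C.Z r hr p' q')
      map_add' := fun x x' => by
        rw [← map_add, mk_j_eq hp hq (lift hp (x + x')) (lift hp x + lift hp x')
          (by simp [map_add, i_lift])]
        congr 1
        exact Subtype.ext (map_add _ _ _)
      map_smul' := fun c x => by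
        rw [RingHom.id_apply, ← map_smul, mk_j_eq hp hq (lift hp (c • x)) (c • lift hp x)
          (by simp [map_smul, i_lift])]
        congr 1
        exact Subtype.ext (map_smul _ _ _) }
    (fun x hx => by
      have h0 := mk_j_eq (hr := hr) hp hq (lift hp x) 0 (by
        rw [i_lift, map_zero]
        exact k_of_mem_B (hr := hr) hx)
      refine LinearMap.mem_ker.2 (h0.trans ((Submodule.Quotient.mk_eq_zero _).2 ?_))
      change C.j p' hq 0 ∈ C.B r hr p' q'
      rw [map_zero]
      exact zero_mem _)

theorem dPage_mk (hp : p + r = p') (hq : q + 1 = q') (x : C.Z r hr p q) (y : C.D (p' - 1) q)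
    (h : C.i (show p ≤ p' - 1 by lia) q y = C.k p q x.1) :
    C.dPage r hr hp hq (Submodule.mkQ _ x) =
      Submodule.mkQ _ (⟨C.j p' hq y, j_mem_Z r hr p' hq y⟩ : C.Z r hr p' q') :=
  mk_j_eq hp hq _ _ ((i_lift hp x).trans h.symm)

theorem dPage_dPage {p'' q'' : ℤ} (hp : p + r = p') (hq : q + 1 = q') (hp' : p' + r = p'')
    (hq' : q' + 1 = q'') (x : C.page r hr p q) :
    C.dPage r hr hp' hq' (C.dPage r hr hp hq x) = 0 := by
  obtain ⟨x, rfl⟩ := Submodule.mkQ_surjective _ x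
  rw [dPage_mk hp hq x _ (i_lift hp x), dPage_mk hp' hq' _ 0 (by rw [map_zero, k_j])]
  refine (Submodule.Quotient.mk_eq_zero _).2 ?_
  change C.j p'' hq' 0 ∈ C.B r hr p'' q''
  rw [map_zero]
  exact zero_mem _

theorem Z_succ_le : C.Z (r + 1) (by lia) p q ≤ C.Z r hr p q := by
  intro x hx
  obtain ⟨y, hy⟩ := (mem_Z (p' := p + r + 1) (by lia)).1 hx
  exact (mem_Z rfl).2 ⟨C.i (show p + r - 1 ≤ p + r + 1 - 1 by lia) q y, by rw [C.i_i, hy]⟩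

/-- The kernel of `d_r` consists of the classes of `(r + 1)`-cycles. -/
theorem dPage_mk_eq_zero_iff (hp : p + r = p') (hq : q + 1 = q') (x : C.Z r hr p q) :
    C.dPage r hr hp hq (Submodule.mkQ _ x) = 0 ↔ x.1 ∈ C.Z (r + 1) (by lia) p q := by
  have hxy := i_lift hp x
  rw [dPage_mk hp hq x _ hxy]
  refine (Submodule.Quotient.mk_eq_zero _).trans ?_
  constructor
  · intro h
    obtain ⟨w, hw, hw'⟩ := (mem_B (hr := hr) hp hq).1 h
    have h0 : C.j p' hq (lift hp x - w) = 0 := by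
      rw [map_sub, hw']
      exact sub_self _
    obtain ⟨z, hz⟩ := ((C.exact_i_j p' hq) _).1 h0
    have : ∀ p'' (h' : p ≤ p''), p' = p'' → ∃ y, C.i h' q y = C.k p q x.1 := by
      intro p'' h' e
      subst e
      exact ⟨z, by
        rw [← C.i_i (sub_le_self p' zero_le_one) (by lia), hz, map_sub, hw, sub_zero, hxy]⟩
    exact this _ _ (by lia)
  · intro h
    obtain ⟨z, hz⟩ := (mem_Z (p' := p' + 1) (by lia)).1 h
    refine (mem_B (hr := hr) hp hq).2 ⟨lift hp x - C.i (show p' - 1 ≤ p' + 1 - 1 by lia) q z, ?_, ?_⟩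
    · rw [map_sub, hxy, C.i_i, hz, sub_self]
    · have : ∀ p'' (h : p' - 1 ≤ p'') (z : C.D p'' q), p' = p'' → C.j p' hq (C.i h q z) = 0 := by
        intro p'' h z e
        subst e
        exact (C.exact_i_j p' hq).apply_apply_eq_zero z
      have h0 := this (p' + 1 - 1) (by omega) z (add_sub_cancel_right p' 1).symm
      rw [map_sub, h0, sub_zero]
      rfl

/-- The image of `d_r` consists of the classes of `(r + 1)`-boundaries. -/
theorem mk_mem_range_dPage_iff (hp : p + r = p') (hq : q + 1 = q') (x : C.Z r hr p' q') :
    Submodule.mkQ _ x ∈ LinearMap.range (C.dPage r hr hp hq) ↔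
      x.1 ∈ C.B (r + 1) (by lia) p' q' := by
  constructor
  · rintro ⟨z, hz⟩
    obtain ⟨z, rfl⟩ := Submodule.mkQ_surjective _ z
    rw [dPage_mk hp hq z _ (i_lift hp z)] at hz
    have h := (Submodule.Quotient.eq _).1 hz
    obtain ⟨w, hw, hw'⟩ := (mem_B (hr := hr) hp hq).1 h
    refine (mem_B (p' := p - 1) (by lia) hq).2 ⟨lift hp z - w, ?_, ?_⟩
    · rw [map_sub, ← C.i_i (show p ≤ p' - 1 by lia) (sub_le_self p zero_le_one), i_lift,
        ← C.i_i (show p ≤ p' - 1 by lia) (sub_le_self p zero_le_one) q w, hw, map_zero, sub_zero]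
      exact (C.exact_k_i p q).apply_apply_eq_zero _
    · rw [map_sub, hw']
      exact sub_sub_cancel _ _
  · intro h
    obtain ⟨y, hy, hy'⟩ := (mem_B (p' := p - 1) (by lia) hq).1 h
    rw [← C.i_i (show p ≤ p' - 1 by lia) (sub_le_self p zero_le_one)] at hy
    obtain ⟨z, hz⟩ := ((C.exact_k_i p q) _).1 hy
    refine ⟨Submodule.mkQ _ ⟨z, (mem_Z hp).2 ⟨y, hz.symm⟩⟩, ?_⟩
    rw [dPage_mk hp hq _ y hz.symm]
    congr 1
    exact Subtype.ext hy'

end differential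

variable (C)

/-- The `r`-th page as a complex with differential of bidegree `(r, 1)`. -/
noncomputable def pageComplex (r : ℤ) (hr : 1 ≤ r) :
    HomologicalComplex (ModuleCat.{u} ℚ) (ComplexShape.up' ((r, 1) : ℤ × ℤ)) where
  X pq := ModuleCat.of ℚ (C.page r hr pq.1 pq.2)
  d pq pq' :=
    if h : pq + (r, 1) = pq' then
      ModuleCat.ofHom (C.dPage r hr (congrArg Prod.fst h) (congrArg Prod.snd h))
    else 0
  shape pq pq' h := dif_neg h
  d_comp_d' a b c hab hbc := by
    have hab' : a + (r, 1) = b := hab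
    have hbc' : b + (r, 1) = c := hbc
    rw [dif_pos hab', dif_pos hbc']
    refine ModuleCat.hom_ext (LinearMap.ext fun x => ?_)
    exact dPage_dPage _ _ _ _ x

/-- The homology of the `r`-th page is the `(r + 1)`-st page. -/
noncomputable def pageIso (r : ℤ) (hr : 1 ≤ r) (pq : ℤ × ℤ) :
    (C.pageComplex r hr).homology pq ≅
      ModuleCat.of ℚ (C.page (r + 1) (by lia) pq.1 pq.2) := by
  have hprev : (ComplexShape.up' ((r, 1) : ℤ × ℤ)).prev pq = pq - (r, 1) :=
    ComplexShape.prev_eq' _ (sub_add_cancel pq (r, 1))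
  have hnext : (ComplexShape.up' ((r, 1) : ℤ × ℤ)).next pq = pq + (r, 1) :=
    ComplexShape.next_eq' _ rfl
  let S := (C.pageComplex r hr).sc' (pq - (r, 1)) pq (pq + (r, 1))
  have hf : S.f = ModuleCat.ofHom (C.dPage r hr (p := pq.1 - r) (q := pq.2 - 1)
      (sub_add_cancel pq.1 r) (sub_add_cancel pq.2 1)) :=
    dif_pos (sub_add_cancel pq (r, 1))
  have hg : S.g = ModuleCat.ofHom (C.dPage r hr (p := pq.1) (q := pq.2) rfl rfl) :=
    dif_pos rfl
  let φ : C.Z (r + 1) (by lia) pq.1 pq.2 →ₗ[ℚ] LinearMap.ker S.g.hom :=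
    LinearMap.codRestrict _ (Submodule.mkQ _ ∘ₗ Submodule.inclusion Z_succ_le) fun x => by
      rw [LinearMap.mem_ker, hg]
      exact (dPage_mk_eq_zero_iff rfl rfl _).2 x.2
  let ψ := (LinearMap.range S.moduleCatToCycles).mkQ ∘ₗ φ
  have hψ : Function.Surjective ψ := by
    refine (Submodule.mkQ_surjective _).comp ?_
    rintro ⟨x, hx⟩
    obtain ⟨x, rfl⟩ := Submodule.mkQ_surjective _ x
    have hx' : S.g.hom (Submodule.mkQ _ x) = 0 := hx
    rw [hg] at hx'
    exact ⟨⟨x.1, (dPage_mk_eq_zero_iff rfl rfl x).1 hx'⟩, rfl⟩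
  have hker : LinearMap.ker ψ = (C.B (r + 1) (by lia) pq.1 pq.2).submoduleOf
      (C.Z (r + 1) (by lia) pq.1 pq.2) := by
    ext x
    refine (Submodule.Quotient.mk_eq_zero _).trans (Iff.trans ?_
      (mk_mem_range_dPage_iff (sub_add_cancel pq.1 r) (sub_add_cancel pq.2 1)
        (Submodule.inclusion (Z_succ_le (hr := hr)) x)))
    constructor
    · rintro ⟨y, hy⟩
      refine ⟨y, Eq.trans ?_ (congrArg Subtype.val hy)⟩
      change _ = S.f.hom y
      rw [hf]
      rfl
    · rintro ⟨y, hy⟩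
      refine ⟨y, Subtype.ext ?_⟩
      refine Eq.trans ?_ hy
      change S.f.hom y = _
      rw [hf]
      rfl
  exact (C.pageComplex r hr).homologyIsoSc' _ pq _ hprev hnext ≪≫ S.moduleCatHomologyIso ≪≫
    ((Submodule.quotEquivOfEq _ _ hker.symm).trans
      (LinearMap.quotKerEquivOfSurjective ψ hψ)).symm.toModuleIso

/-- The spectral sequence of the exact couple, starting with the page `E_1`, with differentials
`d_r : E_r^{p,q} → E_r^{p+r,q+1}`. -/
noncomputable def spectralSequence :
    SpectralSequence (ModuleCat.{u} ℚ) (fun r => ComplexShape.up' ((r, 1) : ℤ × ℤ)) 1 where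
  page r hr := C.pageComplex r hr
  iso r r' pq h hr := by
    subst h
    exact C.pageIso r hr pq

/-- The first page of the spectral sequence is `E`. -/
noncomputable def firstPageIso (pq : ℤ × ℤ) :
    (C.spectralSequence.page 1).X pq ≅ C.E pq.1 pq.2 :=
  (((Submodule.quotEquivOfEqBot _ (by
    rw [B_one]
    exact (Submodule.ker_subtype _))).trans
      (LinearEquiv.ofEq _ _ (Z_one pq.1 pq.2))).trans Submodule.topEquiv).toModuleIso

/-- A graded vector space `G` with compatible maps to the inverse system `D`. -/
structure Cone where
  G : ℤ → ModuleCat.{u} ℚ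
  η : ∀ p q, G q →ₗ[ℚ] C.D p q
  i_η : ∀ {p p' : ℤ} (h : p' ≤ p) q x, C.i h q (η p q x) = η p' q x

variable {C}

/-- The decreasing filtration `F^s G = ker (G → D^{s-1})`. -/
def Cone.F (T : C.Cone) (s q : ℤ) : Submodule ℚ (T.G q) := LinearMap.ker (T.η (s - 1) q)

/-- The spectral sequence of the exact couple converges strongly to `G`: the filtration of `G` is
exhaustive, Hausdorff and complete, and its associated graded object is identified with `E_∞` by
the relation `x ∈ F^p G ↔ z ∈ Z_∞` whenever `k z` is the image of `x` in `D^p`. -/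
structure Cone.ConvergesStrongly (T : C.Cone) : Prop where
  exhaustive : ∀ q (x : T.G q), ∃ s, x ∈ T.F s q
  hausdorff : ∀ q (x : T.G q), (∀ s, x ∈ T.F s q) → x = 0
  complete : ∀ q (x : ℤ → T.G q), (∀ s, x (s + 1) - x s ∈ T.F s q) →
    ∃ y, ∀ s, y - x s ∈ T.F s q
  gr_iso : ∀ p q, ∃ e : (T.F p q ⧸ (T.F (p + 1) q).submoduleOf (T.F p q)) ≃ₗ[ℚ] C.pageInfty p q,
    ∀ (x : T.F p q) (z : C.Zinfty p q),
      e (Submodule.Quotient.mk x) = Submodule.Quotient.mk z ↔ C.k p q z = T.η p q x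

end ExactCouple

namespace DGMod

variable {A : CDGA.{u}}

namespace MinimalBasis

variable {L : DGMod A} (V : L.MinimalBasis)

theorem function_exact_of_exact {S : ShortComplex (ModuleCat.{u} ℚ)} (hS : S.Exact) :
    Function.Exact S.f.hom S.g.hom :=
  (ShortComplex.ShortExact.moduleCat_exact_iff_function_exact S).1 hS

/-- The exact couple with `D^{p,q} = H^q [A ⊗ V^{≤ p}, M]_A` and `E^{p,q} = H^q [A ⊗ V^{= p}, M]_A`
given by the long exact cohomology sequences of the short exact sequences
`0 ⟶ [A ⊗ V^{= p}, M]_A ⟶ [A ⊗ V^{≤ p}, M]_A ⟶ [A ⊗ V^{≤ p - 1}, M]_A ⟶ 0`. -/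
noncomputable def exactCouple (M : DGMod A) : ExactCouple.{u} where
  D p q := (homComplex (V.le p) M).homology q
  E p q := (homComplex (V.slice p) M).homology q
  i h q := (HomologicalComplex.homologyMap (homComplexMap (V.leLE h) M) q).hom
  i_self p q x := by
    have : homComplexMap (V.leLE (le_refl p)) M = 𝟙 _ := rfl
    rw [this, HomologicalComplex.homologyMap_id]
    rfl
  i_i h h' q x := by
    have : homComplexMap (V.leLE (h'.trans h)) M =
      homComplexMap (V.leLE h) M ≫ homComplexMap (V.leLE h') M := rfl
    rw [this, HomologicalComplex.homologyMap_comp]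
    rfl
  j p _ _ h := ((V.sliceSequence_shortExact M p).δ _ _ h).hom
  k p q := (HomologicalComplex.homologyMap (homComplexMap (V.sliceπ p) M) q).hom
  exact_k_i p q := function_exact_of_exact ((V.sliceSequence_shortExact M p).homology_exact₂ q)
  exact_i_j p _ _ h :=
    function_exact_of_exact ((V.sliceSequence_shortExact M p).homology_exact₃ _ _ h)
  exact_j_k p _ _ h :=
    function_exact_of_exact ((V.sliceSequence_shortExact M p).homology_exact₁ _ _ h)

/-- The maps `Ext_A^q(N, M) = H^q [R, M]_A ⟶ H^q [A ⊗ V^{≤ p}, M]_A` induced by a morphism from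
`A ⊗ V` to a cofibrant replacement `R` of `N`. -/
noncomputable def extCone {N : DGMod A} (R : N.CofibrantReplacement) (g : Hom L R.obj)
    (M : DGMod A) : (V.exactCouple M).Cone where
  G q := R.Ext M q
  η p q := (HomologicalComplex.homologyMap (homComplexMap (g.comp (V.leι p)) M) q).hom
  i_η {p p'} h q x := by
    have : homComplexMap (g.comp (V.leι p')) M =
      homComplexMap (g.comp (V.leι p)) M ≫ homComplexMap (V.leLE h) M := rfl
    rw [this, HomologicalComplex.homologyMap_comp]
    rfl

end MinimalBasis
end DGMod

/-!
A minimal module `L = A ⊗ V` is free as a graded module on a well-ordered homogeneous basis whose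
differential is triangular, so maps of any degree out of `L` may be constructed by recursion on the
basis. The single obstruction-theoretic input is `DGMod.MinimalBasis.exists_homD_eq`: to solve
`D h = f` in `[L, M]_A` for a cocycle `f` of degree `q + 1`, with `h` already given on an initial
segment of the basis, one has to bound, for each further generator `v`, a cocycle of `M` of degree
`|v| + q + 1`. This has two consequences.

* Minimal modules are cofibrant (`DGMod.MinimalBasis.cofibrant`): a graded lift through a surjective
  quasi-isomorphism exists by freeness, and its failure to be a chain map is a cocycle with values
  in the acyclic kernel, hence a boundary.
* If the cohomology of `M` vanishes above degree `l`, then `H^q [L, M]_A → H^q [A ⊗ V^{≤ p}, M]_A`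
  is an isomorphism as soon as `l ≤ p + q` (`DGMod.MinimalBasis.homologyMap_leι_bijective`), because
  the generators outside `A ⊗ V^{≤ p}` have degree greater than `p`.

Cofibrant modules are compared as in any model category. A mapping path object turns a
quasi-isomorphism into a surjective one, so that morphisms out of a cofibrant module lift through
quasi-isomorphisms up to homotopy (`DGMod.Cofibrant.exists_lift`). Hence a quasi-isomorphism between
cofibrant modules is a homotopy equivalence and induces isomorphisms on the cohomology of `[-, M]_A`
(`DGMod.homologyMap_bijective_of_cofibrant`), which identifies `H^q [L, M]_A` with `Ext^q_A(N, M)`.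

The generators of a minimal module have degrees bounded below, the index set being well-ordered and
the degree monotone. For fixed `q` the tower `D^{p,q}` therefore vanishes for small `p` and is
constant with value `Ext^q_A(N, M)` for large `p`, and strong convergence of the spectral sequence
of such a tower is formal (`ExactCouple.Cone.convergesStrongly_of_stable`).
-/

/-! ### Cohomology classes of cocycles -/

namespace CochainComplex

variable {R : Type*} [Ring R] (K L : CochainComplex (ModuleCat.{u} R) ℤ) {l m n : ℤ}

/-- The identification of the cocycles `ker d` with the abstract object of cycles. -/
noncomputable def kerToCycles (h : m + 1 = n) :
    ModuleCat.of R (LinearMap.ker (K.d m n).hom) ⟶ K.cycles m :=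
  K.liftCycles (ModuleCat.ofHom (LinearMap.ker (K.d m n).hom).subtype) n
    (ComplexShape.next_eq' _ h) (by ext x; exact x.2)

theorem iCycles_kerToCycles (h : m + 1 = n) (x : LinearMap.ker (K.d m n).hom) :
    (K.iCycles m).hom ((K.kerToCycles h).hom x) = x.1 := by
  change (K.kerToCycles h ≫ K.iCycles m).hom x = _
  rw [kerToCycles, K.liftCycles_i]
  rfl

theorem iCycles_injective : Function.Injective (K.iCycles m).hom :=
  (ModuleCat.mono_iff_injective (K.iCycles m)).1 inferInstance

/-- The cohomology class of a cocycle of a cochain complex of modules. -/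
noncomputable def cocycleClass (h : m + 1 = n) :
    LinearMap.ker (K.d m n).hom →ₗ[R] K.homology m :=
  (K.kerToCycles h ≫ K.homologyπ m).hom

theorem cocycleClass_surjective (h : m + 1 = n) :
    Function.Surjective (K.cocycleClass h) := by
  intro y
  obtain ⟨x, rfl⟩ := (ModuleCat.epi_iff_surjective (K.homologyπ m)).1 inferInstance y
  refine ⟨⟨(K.iCycles m).hom x, ?_⟩, ?_⟩
  · change ((K.iCycles m) ≫ K.d m n).hom x = 0
    rw [K.iCycles_d]
    rfl
  · exact congrArg (K.homologyπ m).hom (K.iCycles_injective (K.iCycles_kerToCycles h _))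

theorem cocycleClass_eq_zero_iff (h' : l + 1 = m) (h : m + 1 = n)
    (x : LinearMap.ker (K.d m n).hom) :
    K.cocycleClass h x = 0 ↔ ∃ y, (K.d l m).hom y = x.1 := by
  have hex : (ShortComplex.mk (K.toCycles l m) (K.homologyπ m)
      (K.toCycles_comp_homologyπ l m)).Exact :=
    ShortComplex.exact_of_g_is_cokernel _
      (K.homologyIsCokernel l m (ComplexShape.prev_eq' _ h'))
  rw [ShortComplex.moduleCat_exact_iff] at hex
  have ht : ∀ y, (K.iCycles m).hom ((K.toCycles l m).hom y) = (K.d l m).hom y := by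
    intro y
    change (K.toCycles l m ≫ K.iCycles m).hom _ = _
    rw [K.toCycles_i]
  constructor
  · intro hx
    obtain ⟨y, hy⟩ := hex _ hx
    exact ⟨y, by rw [← K.iCycles_kerToCycles h x, ← ht]; exact congrArg _ hy⟩
  · rintro ⟨y, hy⟩
    have : (K.toCycles l m).hom y = (K.kerToCycles h).hom x :=
      K.iCycles_injective ((ht y).trans (hy.trans (K.iCycles_kerToCycles h x).symm))
    change (K.homologyπ m).hom ((K.kerToCycles h).hom x) = 0
    rw [← this]
    change (K.toCycles l m ≫ K.homologyπ m).hom y = 0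
    rw [K.toCycles_comp_homologyπ]
    rfl

variable {K L}

theorem homologyMap_cocycleClass (f : K ⟶ L) (h : m + 1 = n)
    (x : LinearMap.ker (K.d m n).hom) (y : LinearMap.ker (L.d m n).hom)
    (hxy : (f.f m).hom x.1 = y.1) :
    (HomologicalComplex.homologyMap f m).hom (K.cocycleClass h x) = L.cocycleClass h y := by
  change (K.kerToCycles h ≫ K.homologyπ m ≫ HomologicalComplex.homologyMap f m).hom x = _
  rw [HomologicalComplex.homologyπ_naturality]
  refine congrArg (L.homologyπ m).hom (L.iCycles_injective ?_)
  refine Eq.trans ?_ (L.iCycles_kerToCycles h y).symm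
  rw [← hxy, ← K.iCycles_kerToCycles h x]
  change (HomologicalComplex.cyclesMap f m ≫ L.iCycles m).hom _ = _
  rw [HomologicalComplex.cyclesMap_i]
  rfl

theorem homologyMap_injective_iff (f : K ⟶ L) (h' : l + 1 = m) (h : m + 1 = n) :
    Function.Injective (HomologicalComplex.homologyMap f m).hom ↔
      ∀ x, (K.d m n).hom x = 0 → ∀ w, (L.d l m).hom w = (f.f m).hom x →
        ∃ y, (K.d l m).hom y = x := by
  have hf : ∀ x, (K.d m n).hom x = 0 → (L.d m n).hom ((f.f m).hom x) = 0 := by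
    intro x hx
    change (f.f m ≫ L.d m n).hom x = 0
    rw [f.comm]
    change (f.f n).hom ((K.d m n).hom x) = 0
    rw [hx, map_zero]
  rw [injective_iff_map_eq_zero]
  constructor
  · intro H x hx w hw
    refine (K.cocycleClass_eq_zero_iff h' h ⟨x, hx⟩).1 (H _ ?_)
    rw [homologyMap_cocycleClass f h ⟨x, hx⟩ ⟨_, hf x hx⟩ rfl]
    exact (L.cocycleClass_eq_zero_iff h' h _).2 ⟨w, hw⟩
  · intro H a ha
    obtain ⟨x, rfl⟩ := K.cocycleClass_surjective h a
    rw [homologyMap_cocycleClass f h x ⟨_, hf x.1 x.2⟩ rfl] at ha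
    obtain ⟨w, hw⟩ := (L.cocycleClass_eq_zero_iff h' h _).1 ha
    exact (K.cocycleClass_eq_zero_iff h' h _).2 (H x.1 x.2 w hw)

theorem homologyMap_surjective_iff (f : K ⟶ L) (h' : l + 1 = m) (h : m + 1 = n) :
    Function.Surjective (HomologicalComplex.homologyMap f m).hom ↔
      ∀ y, (L.d m n).hom y = 0 → ∃ x, (K.d m n).hom x = 0 ∧
        ∃ w, y = (f.f m).hom x + (L.d l m).hom w := by
  have hf : ∀ x, (K.d m n).hom x = 0 → (L.d m n).hom ((f.f m).hom x) = 0 := by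
    intro x hx
    change (f.f m ≫ L.d m n).hom x = 0
    rw [f.comm]
    change (f.f n).hom ((K.d m n).hom x) = 0
    rw [hx, map_zero]
  constructor
  · intro H y hy
    obtain ⟨a, ha⟩ := H (L.cocycleClass h ⟨y, hy⟩)
    obtain ⟨x, rfl⟩ := K.cocycleClass_surjective h a
    rw [homologyMap_cocycleClass f h x ⟨_, hf x.1 x.2⟩ rfl] at ha
    obtain ⟨w, hw⟩ := (L.cocycleClass_eq_zero_iff h' h (⟨y, hy⟩ - ⟨_, hf x.1 x.2⟩)).1
      (by rw [map_sub, ha, sub_self])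
    refine ⟨x.1, x.2, w, ?_⟩
    rw [hw]
    exact (add_sub_cancel _ _).symm
  · intro H b
    obtain ⟨y, rfl⟩ := L.cocycleClass_surjective h b
    obtain ⟨x, hx, w, hw⟩ := H y.1 y.2
    refine ⟨K.cocycleClass h ⟨x, hx⟩, ?_⟩
    rw [homologyMap_cocycleClass f h ⟨x, hx⟩ ⟨_, hf x hx⟩ rfl, ← sub_eq_zero, ← map_sub]
    refine (L.cocycleClass_eq_zero_iff h' h _).2 ⟨-w, ?_⟩
    rw [map_neg]
    change _ = _ - y.1
    rw [hw]
    abel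

theorem exactAt_iff_forall (h' : l + 1 = m) (h : m + 1 = n) :
    K.ExactAt m ↔ ∀ x, (K.d m n).hom x = 0 → ∃ y, (K.d l m).hom y = x := by
  rw [K.exactAt_iff' l m n (ComplexShape.prev_eq' _ h') (ComplexShape.next_eq' _ h),
    ShortComplex.moduleCat_exact_iff]
  rfl

end CochainComplex

namespace DGMod

variable {A : CDGA.{u}}

theorem toComplex_d (M : DGMod A) {m n : ℤ} (h : m + 1 = n) (x : M.gr m) :
    ((M.toComplex.d m n).hom x : M.gr n).1 = M.d x.1 := by
  dsimp only [toComplex]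
  rw [dif_pos h]
  rfl

theorem homComplex_d (N M : DGMod A) {m n : ℤ} (h : m + 1 = n) (f : homDeg N M m) :
    (((homComplex N M).d m n).hom f : homDeg N M n).1 = homD N M m f.1 := by
  dsimp only [homComplex]
  rw [dif_pos h]
  rfl

theorem exactAt_toComplex_iff (M : DGMod A) (n : ℤ) : M.toComplex.ExactAt n ↔
    ∀ x ∈ M.gr n, M.d x = 0 → ∃ y ∈ M.gr (n - 1), M.d y = x := by
  rw [CochainComplex.exactAt_iff_forall (sub_add_cancel n 1) rfl]
  constructor
  · intro H x hx h
    obtain ⟨y, hy⟩ := H ⟨x, hx⟩ (Subtype.ext ((M.toComplex_d rfl _).trans h))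
    exact ⟨y.1, y.2, (M.toComplex_d (sub_add_cancel n 1) y).symm.trans (congrArg Subtype.val hy)⟩
  · intro H x h
    obtain ⟨y, hy, hd⟩ := H x.1 x.2 ((M.toComplex_d rfl _).symm.trans (congrArg Subtype.val h))
    exact ⟨⟨y, hy⟩, Subtype.ext ((M.toComplex_d (sub_add_cancel n 1) _).trans hd)⟩

/-- Quasi-isomorphisms in terms of elements: every cocycle of the target is cohomologous to an
image, and a cocycle of the source whose image is a coboundary is a coboundary. -/
theorem Hom.isQuasiIso_iff {N M : DGMod A} (f : Hom N M) : f.IsQuasiIso ↔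
    (∀ n, ∀ y ∈ M.gr n, M.d y = 0 →
      ∃ x ∈ N.gr n, N.d x = 0 ∧ ∃ w ∈ M.gr (n - 1), y = f.toLin x + M.d w) ∧
    ∀ n, ∀ x ∈ N.gr n, N.d x = 0 → ∀ w ∈ M.gr (n - 1), M.d w = f.toLin x →
      ∃ y ∈ N.gr (n - 1), N.d y = x := by
  have key : f.IsQuasiIso ↔ ∀ n,
      Function.Surjective (HomologicalComplex.homologyMap f.toComplexHom n).hom ∧
      Function.Injective (HomologicalComplex.homologyMap f.toComplexHom n).hom := by
    rw [Hom.IsQuasiIso, quasiIso_iff]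
    refine forall_congr' fun n => ?_
    rw [quasiIsoAt_iff_isIso_homologyMap, ConcreteCategory.isIso_iff_bijective]
    exact and_comm
  rw [key, forall_and]
  refine and_congr (forall_congr' fun n => ?_) (forall_congr' fun n => ?_)
  · rw [CochainComplex.homologyMap_surjective_iff _ (sub_add_cancel n 1) rfl]
    constructor
    · intro H y hy h
      obtain ⟨x, hx, w, hw⟩ := H ⟨y, hy⟩ (Subtype.ext ((M.toComplex_d rfl _).trans h))
      refine ⟨x.1, x.2, (N.toComplex_d rfl _).symm.trans (congrArg Subtype.val hx), w.1, w.2, ?_⟩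
      refine (congrArg Subtype.val hw).trans ?_
      exact congrArg (f.toLin x.1 + ·) (M.toComplex_d (sub_add_cancel n 1) w)
    · intro H y h
      obtain ⟨x, hx, hdx, w, hw, e⟩ :=
        H y.1 y.2 ((M.toComplex_d rfl _).symm.trans (congrArg Subtype.val h))
      refine ⟨⟨x, hx⟩, Subtype.ext ((N.toComplex_d rfl _).trans hdx), ⟨w, hw⟩, Subtype.ext ?_⟩
      refine e.trans ?_
      exact congrArg (f.toLin x + ·) (M.toComplex_d (sub_add_cancel n 1) ⟨w, hw⟩).symm
  · rw [CochainComplex.homologyMap_injective_iff _ (sub_add_cancel n 1) rfl]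
    constructor
    · intro H x hx h w hw e
      obtain ⟨y, hy⟩ := H ⟨x, hx⟩ (Subtype.ext ((N.toComplex_d rfl _).trans h)) ⟨w, hw⟩
        (Subtype.ext ((M.toComplex_d (sub_add_cancel n 1) _).trans e))
      exact ⟨y.1, y.2, (N.toComplex_d (sub_add_cancel n 1) y).symm.trans
        (congrArg Subtype.val hy)⟩
    · intro H x h w e
      obtain ⟨y, hy, hd⟩ := H x.1 x.2 ((N.toComplex_d rfl _).symm.trans (congrArg Subtype.val h))
        w.1 w.2 ((M.toComplex_d (sub_add_cancel n 1) w).symm.trans (congrArg Subtype.val e))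
      exact ⟨⟨y, hy⟩, Subtype.ext ((N.toComplex_d (sub_add_cancel n 1) _).trans hd)⟩

/-- Elementwise criterion for the injectivity of the map on cohomology induced by
precomposition. -/
theorem homologyMap_homComplexMap_injective_iff {N' N : DGMod A} (g : Hom N' N) (M : DGMod A)
    {p q : ℤ} (h : p + 1 = q) :
    Function.Injective (HomologicalComplex.homologyMap (homComplexMap g M) q).hom ↔
      ∀ f ∈ homDeg N M q, homD N M q f = 0 → ∀ w ∈ homDeg N' M p,
        homD N' M p w = f ∘ₗ g.toLin.restrictScalars ℚ → ∃ y ∈ homDeg N M p, homD N M p y = f := by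
  rw [CochainComplex.homologyMap_injective_iff _ h rfl]
  constructor
  · intro H x hx hd w hw e
    obtain ⟨y, hy⟩ := H ⟨x, hx⟩ (Subtype.ext ((homComplex_d N M rfl _).trans hd)) ⟨w, hw⟩
      (Subtype.ext ((homComplex_d N' M h _).trans e))
    exact ⟨y.1, y.2, (homComplex_d N M h y).symm.trans (congrArg Subtype.val hy)⟩
  · intro H x hd w e
    obtain ⟨y, hy, hd⟩ := H x.1 x.2
      ((homComplex_d N M rfl _).symm.trans (congrArg Subtype.val hd))
      w.1 w.2 ((homComplex_d N' M h w).symm.trans (congrArg Subtype.val e))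
    exact ⟨⟨y, hy⟩, Subtype.ext ((homComplex_d N M h _).trans hd)⟩

theorem homologyMap_homComplexMap_surjective_of_lift {N' N : DGMod A} (g : Hom N' N)
    (M : DGMod A) {q : ℤ}
    (H : ∀ f ∈ homDeg N' M q, homD N' M q f = 0 →
      ∃ f' ∈ homDeg N M q, homD N M q f' = 0 ∧ f' ∘ₗ g.toLin.restrictScalars ℚ = f) :
    Function.Surjective (HomologicalComplex.homologyMap (homComplexMap g M) q).hom := by
  rw [CochainComplex.homologyMap_surjective_iff _ (sub_add_cancel q 1) rfl]
  intro y hd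
  obtain ⟨x, hx, hdx, e⟩ := H y.1 y.2
    ((homComplex_d N' M rfl _).symm.trans (congrArg Subtype.val hd))
  refine ⟨⟨x, hx⟩, Subtype.ext ((homComplex_d N M rfl _).trans hdx), 0, ?_⟩
  rw [map_zero, add_zero]
  exact Subtype.ext e.symm

end DGMod

/-! ### Graded-linear maps -/

theorem map_int_unit_smul {X Y F : Type*} [AddCommGroup X] [AddCommGroup Y] [FunLike F X Y]
    [AddMonoidHomClass F X Y] (f : F) (e : ℤˣ) (x : X) : f (e • x) = e • f x := by
  rw [Units.smul_def, Units.smul_def, map_zsmul]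

theorem smul_int_unit_smul {R X : Type*} [Ring R] [AddCommGroup X] [Module R X] (a : R) (e : ℤˣ)
    (x : X) : a • e • x = e • a • x := by
  rw [Units.smul_def, Units.smul_def, smul_comm]

theorem negOnePow_smul_self {X : Type*} [AddCommGroup X] (k : ℤ) (x : X) :
    k.negOnePow • k.negOnePow • x = x := by
  rw [DGMod.negOnePow_smul_smul, Int.negOnePow_even _ ⟨k, rfl⟩, one_smul]

theorem Submodule.int_unit_smul_mem {R X : Type*} [Ring R] [AddCommGroup X] [Module R X]
    (S : Submodule R X) (e : ℤˣ) {x : X} (hx : x ∈ S) : e • x ∈ S := by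
  rw [Units.smul_def]
  exact zsmul_mem hx _

/-- Definition by well-founded recursion: the value at `α` may depend on the values below `α`. -/
theorem exists_wellFounded_rec {ι X : Type*} [LinearOrder ι] [WellFoundedLT ι] [Zero X]
    (G : ι → (ι → X) → X) :
    ∃ m : ι → X, ∀ α, m α = G α fun β => if β < α then m β else 0 := by
  let F : (α : ι) → ((β : ι) → β < α → X) → X :=
    fun α r => G α fun β => if h : β < α then r β h else 0
  refine ⟨(wellFounded_lt (α := ι)).fix F, fun α => ?_⟩
  rw [WellFounded.fix_eq]
  simp only [F, dite_eq_ite]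

namespace DGMod

variable {A : CDGA.{u}} {L M N : DGMod A}

theorem mem_gr_of_eq (M : DGMod A) {m n : ℤ} (h : m = n) {x : M.carrier} (hx : x ∈ M.gr m) :
    x ∈ M.gr n := h ▸ hx

/-- The operator that multiplies the elements of degree `n` by `(-1) ^ (k n)`. Composing with it
turns `A`-linear maps into maps that obey the Koszul sign rule for degree `k`. -/
noncomputable def twist (M : DGMod A) (k : ℤ) : M.carrier →ₗ[ℚ] M.carrier :=
  letI := M.isInternal.chooseDecomposition
  DirectSum.toModule ℚ ℤ M.carrier (fun n => (k * n).negOnePow • (M.gr n).subtype) ∘ₗ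
    (DirectSum.decomposeLinearEquiv M.gr).toLinearMap

theorem twist_of_mem (M : DGMod A) (k : ℤ) {n : ℤ} {x : M.carrier} (hx : x ∈ M.gr n) :
    M.twist k x = (k * n).negOnePow • x := by
  let := M.isInternal.chooseDecomposition
  change DirectSum.toModule ℚ ℤ M.carrier _ (DirectSum.decompose M.gr x) = _
  rw [DirectSum.decompose_of_mem M.gr hx, ← DirectSum.lof_eq_of ℚ, DirectSum.toModule_lof]
  rfl

theorem twist_mem (M : DGMod A) (k : ℤ) {n : ℤ} {x : M.carrier} (hx : x ∈ M.gr n) :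
    M.twist k x ∈ M.gr n := by
  rw [M.twist_of_mem k hx]
  exact Submodule.int_unit_smul_mem _ _ hx

theorem twist_smul (M : DGMod A) (k : ℤ) {i : ℤ} {a : A.carrier} (ha : a ∈ A.gr i)
    (x : M.carrier) : M.twist k (a • x) = (k * i).negOnePow • a • M.twist k x := by
  induction x using M.induction with
  | zero => simp
  | mem n x hx =>
    rw [M.twist_of_mem k hx, M.twist_of_mem k (M.smul_mem i n a ha x hx), smul_int_unit_smul,
      negOnePow_smul_smul, mul_add]
  | add x y hx hy => rw [smul_add, map_add, map_add, hx, hy, smul_add, smul_add]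

theorem twist_twist (M : DGMod A) (k : ℤ) (x : M.carrier) : M.twist k (M.twist k x) = x := by
  induction x using M.induction with
  | zero => simp
  | mem n x hx =>
    rw [M.twist_of_mem k (M.twist_mem k hx), M.twist_of_mem k hx, negOnePow_smul_self]
  | add x y hx hy => rw [map_add, map_add, hx, hy]

theorem d_twist_one (M : DGMod A) (x : M.carrier) :
    M.d (M.twist 1 x) = -M.twist 1 (M.d x) := by
  induction x using M.induction with
  | zero => simp
  | mem n x hx =>
    rw [M.twist_of_mem 1 (M.d_mem n x hx), M.twist_of_mem 1 hx, map_int_unit_smul, one_mul, one_mul,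
      Int.negOnePow_succ, Units.neg_smul, neg_neg]
  | add x y hx hy => simp only [map_add, hx, hy, neg_add]

theorem toLin_comp_mem_homDeg (g : Hom M N) {k : ℤ} {f : L.carrier →ₗ[ℚ] M.carrier}
    (hf : f ∈ homDeg L M k) : g.toLin.restrictScalars ℚ ∘ₗ f ∈ homDeg L N k :=
  ⟨fun n x hx => g.map_mem _ _ (hf.1 n x hx), fun i a ha x => by
    change g.toLin (f (a • x)) = _
    rw [hf.2 i a ha, map_int_unit_smul, map_smul]
    rfl⟩

theorem homD_toLin_comp (g : Hom M N) (k : ℤ) (f : L.carrier →ₗ[ℚ] M.carrier) :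
    homD L N k (g.toLin.restrictScalars ℚ ∘ₗ f) = g.toLin.restrictScalars ℚ ∘ₗ homD L M k f := by
  ext x
  change N.d (g.toLin (f x)) - k.negOnePow • g.toLin (f (L.d x)) =
    g.toLin (M.d (f x) - k.negOnePow • f (L.d x))
  rw [map_sub, map_int_unit_smul, g.map_d]

theorem toLin_mem_homDeg (g : Hom L M) : g.toLin.restrictScalars ℚ ∈ homDeg L M 0 :=
  ⟨fun n x hx => M.mem_gr_of_eq (add_zero n).symm (g.map_mem n x hx), fun i a _ x => by simp⟩

theorem homD_toLin (g : Hom L M) : homD L M 0 (g.toLin.restrictScalars ℚ) = 0 := by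
  ext x
  rw [homD_apply]
  simp [g.map_d]

/-- A cocycle of degree `0` in `[L, M]_A` is a morphism of `A`-modules. -/
def homOfCocycle (f : L.carrier →ₗ[ℚ] M.carrier) (hf : f ∈ homDeg L M 0)
    (hd : homD L M 0 f = 0) : Hom L M where
  toLin :=
    { f with
      map_smul' := fun a x => by
        change f (a • x) = a • f x
        induction a using alg_induction with
        | zero => simp
        | mem i a ha => rw [hf.2 i a ha, zero_mul, Int.negOnePow_zero, one_smul]
        | add a b ha hb => rw [add_smul, map_add, ha, hb, add_smul] }
  map_mem n x hx := M.mem_gr_of_eq (add_zero n) (hf.1 n x hx)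
  map_d x := by
    have := LinearMap.congr_fun hd x
    rw [homD_apply, Int.negOnePow_zero, one_smul, LinearMap.zero_apply, sub_eq_zero] at this
    exact this.symm

theorem comp_mem_homDeg_add {k l m : ℤ} (h : k + l = m) {f : M.carrier →ₗ[ℚ] N.carrier}
    {g : L.carrier →ₗ[ℚ] M.carrier} (hf : f ∈ homDeg M N k) (hg : g ∈ homDeg L M l) :
    f ∘ₗ g ∈ homDeg L N m := by
  subst h
  refine ⟨fun n x hx => ?_, fun i a ha x => ?_⟩
  · exact N.mem_gr_of_eq (by ring) (hf.1 _ _ (hg.1 n x hx))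
  · rw [LinearMap.comp_apply, hg.2 i a ha, map_int_unit_smul, hf.2 i a ha, negOnePow_smul_smul,
      add_comm k l, add_mul]
    rfl

/-- Two maps that obey the same sign rule agree on the `A`-submodule generated by a set on which
they agree. -/
theorem eqOn_span_of_mem_homDeg {k : ℤ} {f g : L.carrier →ₗ[ℚ] M.carrier}
    (hf : f ∈ homDeg L M k) (hg : g ∈ homDeg L M k) {T : Set L.carrier} (h : Set.EqOn f g T)
    {x : L.carrier} (hx : x ∈ Submodule.span A.carrier T) : f x = g x := by
  induction hx using Submodule.span_induction with
  | mem x hx => exact h hx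
  | zero => rw [map_zero, map_zero]
  | add x y _ _ hx hy => rw [map_add, map_add, hx, hy]
  | smul a x _ hx =>
    induction a using alg_induction with
    | zero => simp
    | mem i a ha => rw [hf.2 i a ha, hg.2 i a ha, hx]
    | add a b ha hb => rw [add_smul, map_add, map_add, ha, hb]

/-! ### Extension of maps along a minimal basis -/

namespace MinimalBasis

variable (V : L.MinimalBasis)

theorem ext_homDeg {k : ℤ} {f g : L.carrier →ₗ[ℚ] M.carrier}
    (hf : f ∈ homDeg L M k) (hg : g ∈ homDeg L M k) (h : ∀ α, f (V.v α) = g (V.v α)) : f = g := by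
  refine LinearMap.ext fun x => eqOn_span_of_mem_homDeg hf hg (T := Set.range V.v) ?_ ?_
  · rintro _ ⟨α, rfl⟩
    exact h α
  · rw [V.v.span_eq]
    trivial

/-- The map of degree `k` with prescribed values on the basis. -/
noncomputable def extend (M : DGMod A) (k : ℤ) (m : V.ι → M.carrier) :
    L.carrier →ₗ[ℚ] M.carrier :=
  (V.v.constr ℕ fun α => (k * V.deg α).negOnePow • m α).restrictScalars ℚ ∘ₗ L.twist k

theorem extend_v (k : ℤ) (m : V.ι → M.carrier) (α : V.ι) : V.extend M k m (V.v α) = m α := by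
  change V.v.constr ℕ _ (L.twist k (V.v α)) = _
  rw [L.twist_of_mem k (V.v_mem α), map_int_unit_smul, Module.Basis.constr_basis,
    negOnePow_smul_self]

theorem extend_mem (k : ℤ) (m : V.ι → M.carrier) (hm : ∀ α, m α ∈ M.gr (V.deg α + k)) :
    V.extend M k m ∈ homDeg L M k := by
  have hs : ∀ i, ∀ a ∈ A.gr i, ∀ x, V.extend M k m (a • x) =
      (k * i).negOnePow • (a • V.extend M k m x) := by
    intro i a ha x
    change V.v.constr ℕ _ (L.twist k (a • x)) = _
    rw [L.twist_smul k ha, map_int_unit_smul, map_smul]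
    rfl
  refine ⟨fun n x hx => ?_, hs⟩
  have key : ∀ x ∈ Submodule.span A.carrier (Set.range V.v), ∀ n,
      V.extend M k m (L.proj n x) ∈ M.gr (n + k) := by
    intro x hx
    induction hx using Submodule.span_induction with
    | mem x hx =>
      obtain ⟨α, rfl⟩ := hx
      intro n
      by_cases h : V.deg α = n
      · subst h
        rw [L.proj_same (V.v_mem α), extend_v]
        exact hm α
      · rw [L.proj_ne (V.v_mem α) h, map_zero]
        exact zero_mem _
    | zero => intro n; rw [map_zero, map_zero]; exact zero_mem _
    | add x y _ _ hx hy => intro n; rw [map_add, map_add]; exact add_mem (hx n) (hy n)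
    | smul a x _ hx =>
      intro n
      induction a using alg_induction with
      | zero => simp
      | mem i a ha =>
        have h := L.proj_smul ha (n - i) x
        rw [add_sub_cancel] at h
        rw [h, hs i a ha]
        refine Submodule.int_unit_smul_mem _ _ ?_
        exact M.mem_gr_of_eq (by ring) (M.smul_mem i _ a ha _ (hx (n - i)))
      | add a b ha hb => rw [add_smul, map_add, map_add]; exact add_mem ha hb
  have := key x (by rw [V.v.span_eq]; trivial) n
  rwa [L.proj_same hx] at this

/-- The obstruction-theoretic heart of the argument. Let `f` be a cocycle of degree `q + 1` in
`[L, M]_A`, and let `h₀` be a map of degree `q` whose boundary agrees with `f` on an initial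
segment `S` of the basis. If `M` is exact in the degrees `|v α| + q + 1` for `α ∉ S`, then `h₀` can
be changed outside `S` to a map with boundary `f`: the value on `v α` is found by recursion on
`α`. -/
theorem exists_homD_eq {q q' : ℤ} (hq : q + 1 = q') (S : Set V.ι) (hS : IsLowerSet S)
    (hM : ∀ α ∉ S, M.toComplex.ExactAt (V.deg α + q'))
    {f : L.carrier →ₗ[ℚ] M.carrier} (hf : f ∈ homDeg L M q') (hdf : homD L M q' f = 0)
    {h₀ : L.carrier →ₗ[ℚ] M.carrier} (hh₀ : h₀ ∈ homDeg L M q)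
    (hS₀ : ∀ α ∈ S, homD L M q h₀ (V.v α) = f (V.v α)) :
    ∃ h ∈ homDeg L M q, homD L M q h = f ∧ ∀ α ∈ S, h (V.v α) = h₀ (V.v α) := by
  classical
  -- The equation `d y = f (v α) + (-1) ^ q h (d (v α))` to be solved for the value `y` on `v α`.
  let P : V.ι → (V.ι → M.carrier) → M.carrier → Prop := fun α m y =>
    y ∈ M.gr (V.deg α + q) ∧
      M.d y = f (V.v α) + q.negOnePow • V.extend M q m (L.d (V.v α))
  obtain ⟨m, hm⟩ := exists_wellFounded_rec fun α (m : V.ι → M.carrier) =>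
    if α ∈ S then h₀ (V.v α) else if h : ∃ y, P α m y then h.choose else 0
  have hmem : ∀ α, m α ∈ M.gr (V.deg α + q) := by
    intro α
    rw [hm α]
    split_ifs with h1 h2
    · exact hh₀.1 _ _ (V.v_mem α)
    · exact h2.choose_spec.1
    · exact zero_mem _
  have hmS : ∀ α ∈ S, m α = h₀ (V.v α) := fun α hα => by rw [hm α, if_pos hα]
  set h := V.extend M q m with hh
  have hhm : h ∈ homDeg L M q := V.extend_mem q m hmem
  have hdh : homD L M q h ∈ homDeg L M q' := homD_mem L M q q' hq h hhm
  have main : ∀ α, homD L M q h (V.v α) = f (V.v α) := by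
    intro α
    induction α using WellFoundedLT.induction with
    | ind α ih =>
    by_cases hα : α ∈ S
    · rw [← hS₀ α hα, homD_apply, homD_apply, hh, extend_v, hmS α hα]
      congr 2
      refine eqOn_span_of_mem_homDeg hhm hh₀ ?_ (V.d_v_mem α)
      rintro _ ⟨β, hβ, rfl⟩
      rw [hh, extend_v, hmS β (hS (le_of_lt hβ) hα)]
    · have htr : V.extend M q (fun β => if β < α then m β else 0) (L.d (V.v α)) =
          h (L.d (V.v α)) := by
        refine eqOn_span_of_mem_homDeg (V.extend_mem q _ fun β => ?_) hhm ?_ (V.d_v_mem α)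
        · split_ifs
          · exact hmem β
          · exact zero_mem _
        · rintro _ ⟨β, hβ, rfl⟩
          rw [hh, extend_v, extend_v]
          exact if_pos hβ
      have hbelow : homD L M q h (L.d (V.v α)) = f (L.d (V.v α)) := by
        refine eqOn_span_of_mem_homDeg hdh hf ?_ (V.d_v_mem α)
        rintro _ ⟨β, hβ, rfl⟩
        exact ih β hβ
      have hex : ∃ y, P α (fun β => if β < α then m β else 0) y := by
        obtain ⟨y, hy, hyd⟩ := (M.exactAt_toComplex_iff _).1 (hM α hα)
          (f (V.v α) + q.negOnePow • h (L.d (V.v α)))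
          (add_mem (hf.1 _ _ (V.v_mem α)) (Submodule.int_unit_smul_mem _ _
            (M.mem_gr_of_eq (by lia) (hhm.1 _ _ (L.d_mem _ _ (V.v_mem α))))))
          (by
            have e := LinearMap.congr_fun hdf (V.v α)
            rw [homD_apply, LinearMap.zero_apply, sub_eq_zero] at e
            rw [homD_apply, L.d_d, map_zero, smul_zero, sub_zero] at hbelow
            rw [map_add, map_int_unit_smul, hbelow, e, ← hq, Int.negOnePow_succ, Units.neg_smul,
              neg_add_cancel])
        refine ⟨y, M.mem_gr_of_eq (by lia) hy, ?_⟩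
        rw [hyd, htr]
      have hmα : P α (fun β => if β < α then m β else 0) (m α) := by
        rw [hm α, if_neg hα, dif_pos hex]
        exact hex.choose_spec
      rw [homD_apply, ← htr, hh, extend_v, hmα.2, add_sub_cancel_right]
  exact ⟨h, hhm, V.ext_homDeg hdh hf main, fun α hα => by rw [hh, extend_v, hmS α hα]⟩

end MinimalBasis

end DGMod

namespace DGMod

variable {A : CDGA.{u}} {L M N X Y : DGMod A}

/-! ### Cofibrancy of minimal modules -/

theorem ker_isHomogeneous (p : Hom X Y) : X.IsHomogeneous (LinearMap.ker p.toLin) := by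
  intro x hx n
  rw [LinearMap.mem_ker] at hx ⊢
  rw [proj_map _ p.map_mem, hx, map_zero]

theorem d_mem_ker (p : Hom X Y) : ∀ x ∈ LinearMap.ker p.toLin, X.d x ∈ LinearMap.ker p.toLin := by
  intro x hx
  rw [LinearMap.mem_ker] at hx ⊢
  rw [p.map_d, hx, map_zero]

/-- The kernel of a morphism of `A`-modules. -/
def Hom.ker (p : Hom X Y) : DGMod A :=
  X.sub (LinearMap.ker p.toLin) (ker_isHomogeneous p) (d_mem_ker p)

theorem exists_mem_gr_of_surjective {p : Hom X Y} (hp : Function.Surjective p.toLin) {n : ℤ}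
    {y : Y.carrier} (hy : y ∈ Y.gr n) : ∃ x ∈ X.gr n, p.toLin x = y := by
  obtain ⟨x, rfl⟩ := hp y
  exact ⟨X.proj n x, X.proj_mem n x, by rw [proj_map _ p.map_mem, Y.proj_same hy]⟩

theorem ker_exactAt {p : Hom X Y} (hp : Function.Surjective p.toLin) (hq : p.IsQuasiIso) (n : ℤ) :
    p.ker.toComplex.ExactAt n := by
  rw [exactAt_toComplex_iff]
  rintro ⟨x, hx⟩ (hxn : x ∈ X.gr n) hd
  have hd : X.d x = 0 := congrArg Subtype.val hd
  rw [Hom.isQuasiIso_iff] at hq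
  rw [LinearMap.mem_ker] at hx
  obtain ⟨x₁, hx₁, hdx₁⟩ := hq.2 n x hxn hd 0 (zero_mem _) (by rw [map_zero, hx])
  -- `x₁` bounds `x`; correct it by a cocycle and a coboundary so that it lies in the kernel.
  obtain ⟨x₂, hx₂, hdx₂, w, hw, e⟩ := hq.1 (n - 1) (p.toLin x₁) (p.map_mem _ _ hx₁)
    (by rw [← p.map_d, hdx₁, hx])
  obtain ⟨u, hu, rfl⟩ := exists_mem_gr_of_surjective hp hw
  refine ⟨⟨x₁ - x₂ - X.d u, ?_⟩, ?_, Subtype.ext ?_⟩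
  · rw [LinearMap.mem_ker, map_sub, map_sub, p.map_d, e]
    abel
  · exact sub_mem (sub_mem hx₁ hx₂) (X.mem_gr_of_eq (sub_add_cancel _ _) (X.d_mem _ _ hu))
  · change X.d (x₁ - x₂ - X.d u) = x
    rw [map_sub, map_sub, hdx₁, hdx₂, X.d_d, sub_zero, sub_zero]

/-- A map of degree `0` lifts because `L` is free as a graded module; its failure to commute with
the differentials takes values in the acyclic kernel of `p`, where it is a boundary. -/
theorem MinimalBasis.cofibrant (V : L.MinimalBasis) : L.Cofibrant := by
  intro X Y p hp hq f
  choose m hm hpm using fun α =>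
    exists_mem_gr_of_surjective hp (f.map_mem _ _ (V.v_mem α))
  have hm' : ∀ α, m α ∈ X.gr (V.deg α + 0) := fun α => X.mem_gr_of_eq (add_zero _).symm (hm α)
  have hg := V.extend_mem 0 m hm'
  set g := V.extend X 0 m with hgdef
  have hpg : p.toLin.restrictScalars ℚ ∘ₗ g = f.toLin.restrictScalars ℚ := by
    refine V.ext_homDeg (toLin_comp_mem_homDeg p hg) (toLin_mem_homDeg f) fun α => ?_
    change p.toLin (g (V.v α)) = f.toLin (V.v α)
    rw [hgdef, extend_v, hpm]
  have hker : ∀ x, homD L X 0 g x ∈ (LinearMap.ker p.toLin).restrictScalars ℚ := by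
    intro x
    have := LinearMap.congr_fun (homD_toLin_comp p 0 g) x
    rw [hpg, homD_toLin] at this
    exact this.symm
  let c : L.carrier →ₗ[ℚ] p.ker.carrier :=
    (homD L X 0 g).codRestrict ((LinearMap.ker p.toLin).restrictScalars ℚ) hker
  have hDg : homD L X 0 g ∈ homDeg L X 1 := homD_mem L X 0 1 rfl g hg
  let ι : Hom p.ker X := X.subι _ (ker_isHomogeneous p) (d_mem_ker p)
  have hι : Function.Injective ι.toLin := Subtype.val_injective
  have hc : c ∈ homDeg L p.ker 1 := by
    refine ⟨fun n x hx => hDg.1 n x hx, fun i a ha x => hι ?_⟩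
    rw [map_int_unit_smul]
    exact hDg.2 i a ha x
  have hdc : homD L p.ker 1 c = 0 := by
    refine LinearMap.ext fun x => hι ?_
    have := LinearMap.congr_fun (homD_toLin_comp ι 1 c) x
    rw [LinearMap.zero_apply, map_zero]
    exact this.symm.trans (LinearMap.congr_fun (homD_homD L X 0 g) x)
  obtain ⟨h, hh, hdh, -⟩ := V.exists_homD_eq (zero_add 1) ∅ isLowerSet_empty
    (fun α _ => ker_exactAt hp hq _) hc hdc (zero_mem (homDeg L p.ker 0)) (by simp)
  have hιh := toLin_comp_mem_homDeg ι hh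
  refine ⟨homOfCocycle (g - ι.toLin.restrictScalars ℚ ∘ₗ h) (sub_mem hg hιh) ?_, ?_⟩
  · rw [map_sub, homD_toLin_comp, hdh, sub_eq_zero]
    rfl
  · refine Hom.ext (LinearMap.ext fun x => ?_)
    change p.toLin (g x - (h x).1) = f.toLin x
    rw [map_sub, LinearMap.mem_ker.1 (h x).2, sub_zero]
    exact LinearMap.congr_fun hpg x

/-! ### The mapping path object and the comparison of cofibrant modules -/

theorem proj_eq_zero_of_notMem (M : DGMod A) {x : M.carrier} {s : Finset ℤ}
    (hs : x = ∑ n ∈ s, M.proj n x) {n : ℤ} (hn : n ∉ s) : M.proj n x = 0 := by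
  rw [hs, map_sum]
  refine Finset.sum_eq_zero fun m hm => M.proj_ne (M.proj_mem m x) ?_
  rintro rfl
  exact hn hm

theorem exists_eq_sum_proj_of_subset (M : DGMod A) (x : M.carrier) :
    ∃ s : Finset ℤ, ∀ t, s ⊆ t → x = ∑ n ∈ t, M.proj n x := by
  obtain ⟨s, hs⟩ := M.proj_sum x
  refine ⟨s, fun t ht => hs.trans (Finset.sum_subset ht fun n _ hn => ?_)⟩
  exact M.proj_eq_zero_of_notMem hs hn

/-- The mapping path object `X ⊕ N ⊕ N[-1]`, with differential
`d (x, a, b) = (d x, d a, σ a + d b)` where `σ a = (-1) ^ |a| a`. The summand `N ⊕ N[-1]` is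
contractible. The sign is put into the differential rather than into the action of `A`, so that
`A` acts componentwise. -/
noncomputable def path (X N : DGMod A) : DGMod A where
  carrier := X.carrier × N.carrier × N.carrier
  gr n := (X.gr n).prod ((N.gr n).prod (N.gr (n - 1)))
  isInternal := isInternal_of_proj _
    (fun n => (X.proj n).prodMap ((N.proj n).prodMap (N.proj (n - 1))))
    (fun n x hx => Prod.ext (X.proj_same hx.1)
      (Prod.ext (N.proj_same hx.2.1) (N.proj_same hx.2.2)))
    (fun m n h x hx => Prod.ext (X.proj_ne hx.1 h)
      (Prod.ext (N.proj_ne hx.2.1 h) (N.proj_ne hx.2.2 (by lia))))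
    (fun x => by
      obtain ⟨s₁, h₁⟩ := X.exists_eq_sum_proj_of_subset x.1
      obtain ⟨s₂, h₂⟩ := N.exists_eq_sum_proj_of_subset x.2.1
      obtain ⟨s₃, h₃⟩ := N.exists_eq_sum_proj_of_subset x.2.2
      -- The third component of degree `n` lies in `N` in degree `n - 1`, so its support is shifted.
      let e : ℤ ↪ ℤ := (Equiv.addRight (1 : ℤ)).toEmbedding
      refine ⟨s₁ ∪ s₂ ∪ s₃.map e, fun n => (X.proj n x.1, N.proj n x.2.1, N.proj (n - 1) x.2.2),
        fun n => ⟨X.proj_mem _ _, N.proj_mem _ _, N.proj_mem _ _⟩, ?_⟩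
      rw [Prod.ext_iff, Prod.ext_iff, Prod.fst_sum, Prod.snd_sum, Prod.fst_sum, Prod.snd_sum]
      refine ⟨h₁ _ ?_, h₂ _ ?_, ?_⟩
      · exact Finset.subset_union_left.trans Finset.subset_union_left
      · exact Finset.subset_union_right.trans Finset.subset_union_left
      · have := h₃ ((s₁ ∪ s₂ ∪ s₃.map e).map (Equiv.addRight (-1 : ℤ)).toEmbedding) (by
          intro n hn
          refine Finset.mem_map.2 ⟨n + 1, Finset.mem_union_right _ ?_, ?_⟩
          · exact Finset.mem_map.2 ⟨n, hn, rfl⟩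
          · exact add_neg_cancel_right n 1)
        rw [Finset.sum_map] at this
        exact this)
  smul_mem i j a ha x hx := ⟨X.smul_mem i j a ha _ hx.1, N.smul_mem i j a ha _ hx.2.1,
    N.mem_gr_of_eq (by ring) (N.smul_mem i (j - 1) a ha _ hx.2.2)⟩
  d := (X.d ∘ₗ LinearMap.fst _ _ _).prod
    ((N.d ∘ₗ LinearMap.fst _ _ _ ∘ₗ LinearMap.snd _ _ _).prod
      (N.twist 1 ∘ₗ LinearMap.fst _ _ _ ∘ₗ LinearMap.snd _ _ _ +
        N.d ∘ₗ LinearMap.snd _ _ _ ∘ₗ LinearMap.snd _ _ _))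
  d_mem i x hx := ⟨X.d_mem i _ hx.1, N.d_mem i _ hx.2.1,
    N.mem_gr_of_eq (by ring) (add_mem (N.twist_mem 1 hx.2.1)
      (N.mem_gr_of_eq (by ring) (N.d_mem _ _ hx.2.2)))⟩
  d_d x := by
    refine Prod.ext (X.d_d _) (Prod.ext (N.d_d _) ?_)
    change N.twist 1 (N.d x.2.1) + N.d (N.twist 1 x.2.1 + N.d x.2.2) = 0
    rw [map_add, N.d_d, d_twist_one]
    abel
  leibniz i a ha x := by
    refine Prod.ext (X.leibniz i a ha _) (Prod.ext (N.leibniz i a ha _) ?_)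
    change N.twist 1 (a • x.2.1) + N.d (a • x.2.2) =
      A.d a • x.2.2 + i.negOnePow • a • (N.twist 1 x.2.1 + N.d x.2.2)
    rw [N.leibniz i a ha, N.twist_smul 1 ha, one_mul, smul_add, smul_add]
    abel

theorem path_d (X N : DGMod A) (x : (path X N).carrier) :
    (path X N).d x = (X.d x.1, N.d x.2.1, N.twist 1 x.2.1 + N.d x.2.2) := rfl

theorem mem_path_gr {x : (path X N).carrier} {n : ℤ} :
    x ∈ (path X N).gr n ↔ x.1 ∈ X.gr n ∧ x.2.1 ∈ N.gr n ∧ x.2.2 ∈ N.gr (n - 1) := Iff.rfl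

/-- The projection of the mapping path object onto `X`. -/
noncomputable def pathFst (X N : DGMod A) : Hom (path X N) X where
  toLin := LinearMap.fst _ _ _
  map_mem _ _ hx := hx.1
  map_d _ := rfl

/-- The map `(x, a, b) ↦ r x + a` from the mapping path object to `N`. -/
noncomputable def pathEval (r : Hom X N) : Hom (path X N) N where
  toLin := r.toLin ∘ₗ LinearMap.fst _ _ _ + LinearMap.fst _ _ _ ∘ₗ LinearMap.snd _ _ _
  map_mem n _ hx := add_mem (r.map_mem n _ hx.1) hx.2.1
  map_d x := by
    change r.toLin (X.d x.1) + N.d x.2.1 = N.d (r.toLin x.1 + x.2.1)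
    rw [map_add, r.map_d]

theorem pathEval_surjective (r : Hom X N) : Function.Surjective (pathEval r).toLin := fun y =>
  ⟨((0, y, 0) : X.carrier × N.carrier × N.carrier), by
    change r.toLin 0 + y = y
    rw [map_zero, zero_add]⟩

theorem pathEval_isQuasiIso {r : Hom X N} (hr : r.IsQuasiIso) : (pathEval r).IsQuasiIso := by
  rw [Hom.isQuasiIso_iff] at hr ⊢
  constructor
  · intro n y hy hd
    obtain ⟨x, hx, hdx, w, hw, e⟩ := hr.1 n y hy hd
    refine ⟨(x, 0, 0), ⟨hx, zero_mem _, zero_mem _⟩, ?_, w, hw, ?_⟩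
    · refine Prod.ext hdx (Prod.ext (map_zero N.d) ?_)
      change N.twist 1 0 + N.d 0 = 0
      rw [map_zero, map_zero, add_zero]
    · change y = r.toLin x + 0 + N.d w
      rw [add_zero, e]
  · rintro n ⟨x, a, b⟩ ⟨hx, ha, hb⟩ hd w hw e
    have hd₁ : X.d x = 0 := congrArg Prod.fst hd
    have hd₃ : N.twist 1 a + N.d b = 0 := congrArg (fun z => z.2.2) hd
    change N.d w = r.toLin x + a at e
    change b ∈ N.gr (n - 1) at hb
    -- The cocycle condition on the third component makes `σ b` a primitive of `a`.
    have ha' : N.d (N.twist 1 b) = a := by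
      rw [d_twist_one, eq_neg_of_add_eq_zero_right hd₃, map_neg, neg_neg, twist_twist]
    obtain ⟨x', hx', hdx'⟩ := hr.2 n x hx hd₁ (w - N.twist 1 b)
      (sub_mem hw (N.twist_mem 1 hb)) (by rw [map_sub, ha', e, add_sub_cancel_right])
    refine ⟨(x', N.twist 1 b, 0), ⟨hx', N.twist_mem 1 hb, zero_mem _⟩, ?_⟩
    refine Prod.ext hdx' (Prod.ext ha' ?_)
    change N.twist 1 (N.twist 1 b) + N.d 0 = b
    rw [twist_twist, map_zero, add_zero]

/-- A morphism out of a cofibrant module lifts up to homotopy through any quasi-isomorphism. The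
replacement of `r` by the surjection `(x, a, b) ↦ r x + a` costs the summand `a` of the lifted
map, which is null-homotopic through `σ b`. -/
theorem Cofibrant.exists_lift (hL : L.Cofibrant) (r : Hom X N) (hr : r.IsQuasiIso)
    (φ : Hom L N) : ∃ g : Hom L X, (r.comp g).Homotopic φ := by
  obtain ⟨ψ, hψ⟩ := hL _ _ (pathEval r) (pathEval_surjective r) (pathEval_isQuasiIso hr) φ
  have hψ' : ∀ x, r.toLin (ψ.toLin x).1 + (ψ.toLin x).2.1 = φ.toLin x := fun x =>
    LinearMap.congr_fun (congrArg Hom.toLin hψ) x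
  refine ⟨(pathFst X N).comp ψ,
    -(N.twist 1 ∘ₗ LinearMap.snd ℚ N.carrier N.carrier ∘ₗ LinearMap.snd ℚ X.carrier _ ∘ₗ
      ψ.toLin.restrictScalars ℚ), neg_mem ⟨fun n x hx => ?_, fun i a ha x => ?_⟩, fun x => ?_⟩
  · exact N.twist_mem 1 (mem_path_gr.1 (ψ.map_mem n x hx)).2.2
  · change N.twist 1 (ψ.toLin (a • x)).2.2 = _ • a • N.twist 1 (ψ.toLin x).2.2
    rw [map_smul]
    change N.twist 1 (a • (ψ.toLin x).2.2) = _
    rw [N.twist_smul 1 ha, one_mul, neg_one_mul, Int.negOnePow_neg]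
  · change r.toLin (ψ.toLin x).1 - φ.toLin x =
      N.d (-N.twist 1 (ψ.toLin x).2.2) + -N.twist 1 (ψ.toLin (L.d x)).2.2
    rw [ψ.map_d, path_d, map_neg, d_twist_one, neg_neg, map_add, twist_twist, ← hψ' x]
    abel

theorem Hom.Homotopic.exists_sub_eq_d {f g : Hom L N} (h : f.Homotopic g) {n : ℤ} {x : L.carrier}
    (hx : x ∈ L.gr n) (hd : L.d x = 0) :
    ∃ w ∈ N.gr (n - 1), f.toLin x - g.toLin x = N.d w := by
  obtain ⟨h, hh, e⟩ := h
  exact ⟨h x, hh.1 n x hx, by rw [e, hd, map_zero, add_zero]⟩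

theorem Hom.isQuasiIso_of_comp_homotopic {r : Hom X N} {g : Hom L X} {φ : Hom L N}
    (hr : r.IsQuasiIso) (hφ : φ.IsQuasiIso) (h : (r.comp g).Homotopic φ) : g.IsQuasiIso := by
  rw [Hom.isQuasiIso_iff] at hr hφ ⊢
  constructor
  · intro n y hy hdy
    obtain ⟨x, hx, hdx, w, hw, e⟩ := hφ.1 n (r.toLin y) (r.map_mem _ _ hy)
      (by rw [← r.map_d, hdy, map_zero])
    obtain ⟨w', hw', e'⟩ := h.exists_sub_eq_d hx hdx
    have e' : r.toLin (g.toLin x) - φ.toLin x = N.d w' := e'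
    obtain ⟨z, hz, hdz⟩ := hr.2 n (y - g.toLin x) (sub_mem hy (g.map_mem _ _ hx))
      (by rw [map_sub, ← g.map_d, hdy, hdx, map_zero, sub_zero]) (w - w') (sub_mem hw hw')
      (by rw [map_sub, map_sub, e, ← e']; abel)
    exact ⟨x, hx, hdx, z, hz, by rw [hdz, add_sub_cancel]⟩
  · intro n x hx hdx w hw e
    obtain ⟨w', hw', e'⟩ := h.exists_sub_eq_d hx hdx
    have e' : r.toLin (g.toLin x) - φ.toLin x = N.d w' := e'
    refine hφ.2 n x hx hdx (r.toLin w - w') (sub_mem (r.map_mem _ _ hw) hw') ?_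
    rw [map_sub, ← e', ← r.map_d, e, sub_sub_cancel]

/-- The identity morphism. -/
def Hom.id (L : DGMod A) : Hom L L where
  toLin := LinearMap.id
  map_mem _ _ hx := hx
  map_d _ := rfl

theorem Hom.isQuasiIso_id (L : DGMod A) : (Hom.id L).IsQuasiIso := by
  have : (Hom.id L).toComplexHom = 𝟙 L.toComplex := rfl
  rw [Hom.IsQuasiIso, this]
  infer_instance

/-- Homotopic morphisms induce the same map on the cohomology of `[-, M]_A`. -/
theorem Hom.Homotopic.homologyMap_eq {f g : Hom L N} (h : f.Homotopic g) (M : DGMod A) (q : ℤ) :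
    HomologicalComplex.homologyMap (homComplexMap f M) q =
      HomologicalComplex.homologyMap (homComplexMap g M) q := by
  obtain ⟨h, hh, e⟩ := h
  rw [← sub_eq_zero, ← HomologicalComplex.homologyMap_sub]
  refine ModuleCat.hom_ext (LinearMap.ext fun c => ?_)
  obtain ⟨x, rfl⟩ := (homComplex N M).cocycleClass_surjective (rfl : q + 1 = q + 1) c
  have hx : homD N M q x.1.1 = 0 := (homComplex_d N M rfl _).symm.trans (congrArg Subtype.val x.2)
  have hmem : q.negOnePow • (x.1.1 ∘ₗ h) ∈ homDeg L M (q - 1) :=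
    Submodule.int_unit_smul_mem _ _ (comp_mem_homDeg_add (by ring) x.1.2 hh)
  have hd : homD L M (q - 1) (q.negOnePow • (x.1.1 ∘ₗ h)) =
      x.1.1 ∘ₗ f.toLin.restrictScalars ℚ - x.1.1 ∘ₗ g.toLin.restrictScalars ℚ := by
    refine LinearMap.ext fun y => ?_
    have h1 := LinearMap.congr_fun hx (h y)
    rw [homD_apply, LinearMap.zero_apply, sub_eq_zero] at h1
    change M.d (q.negOnePow • x.1.1 (h y)) - (q - 1).negOnePow • q.negOnePow • x.1.1 (h (L.d y)) =
      x.1.1 (f.toLin y) - x.1.1 (g.toLin y)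
    rw [← map_sub, e, map_add, map_int_unit_smul, h1, negOnePow_smul_self, Int.negOnePow_sub,
      Int.negOnePow_one, mul_neg_one, Units.neg_smul, negOnePow_smul_self, sub_neg_eq_add]
  have hy : ((homComplex L M).d q (q + 1)).hom
      ((homComplexMap f M - homComplexMap g M).f q x.1) = 0 := by
    refine (congrArg ((homComplex L M).d q (q + 1)).hom (?_ : _ =
      ((homComplex L M).d (q - 1) q).hom ⟨_, hmem⟩)).trans ?_
    · exact Subtype.ext ((homComplex_d L M (sub_add_cancel q 1) _).trans hd).symm
    · exact LinearMap.congr_fun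
        (congrArg ModuleCat.Hom.hom ((homComplex L M).d_comp_d (q - 1) q (q + 1))) ⟨_, hmem⟩
  rw [CochainComplex.homologyMap_cocycleClass _ rfl x ⟨_, hy⟩ rfl]
  refine ((homComplex L M).cocycleClass_eq_zero_iff (sub_add_cancel q 1) rfl _).2
    ⟨⟨_, hmem⟩, Subtype.ext ((homComplex_d L M (sub_add_cancel q 1) _).trans hd)⟩

theorem homologyMap_leftInverse (M : DGMod A) (q : ℤ) {s : Hom X L} {g : Hom L X}
    (h : (g.comp s).Homotopic (Hom.id X)) :
    Function.LeftInverse (HomologicalComplex.homologyMap (homComplexMap s M) q).hom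
      (HomologicalComplex.homologyMap (homComplexMap g M) q).hom := by
  intro x
  have h1 : homComplexMap (g.comp s) M = homComplexMap g M ≫ homComplexMap s M := rfl
  have h2 : homComplexMap (Hom.id X) M = 𝟙 _ := rfl
  change (HomologicalComplex.homologyMap (homComplexMap g M) q ≫
    HomologicalComplex.homologyMap (homComplexMap s M) q).hom x = x
  rw [← HomologicalComplex.homologyMap_comp, ← h1, h.homologyMap_eq, h2,
    HomologicalComplex.homologyMap_id]
  rfl

/-- A quasi-isomorphism `g` between cofibrant modules induces isomorphisms on the cohomology of
`[-, M]_A`: it has a right inverse `s` up to homotopy, which is again a quasi-isomorphism and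
therefore has a right inverse up to homotopy as well. -/
theorem homologyMap_bijective_of_cofibrant (hL : L.Cofibrant) (hX : X.Cofibrant) (g : Hom L X)
    (hg : g.IsQuasiIso) (M : DGMod A) (q : ℤ) :
    Function.Bijective (HomologicalComplex.homologyMap (homComplexMap g M) q).hom := by
  obtain ⟨s, hs⟩ := hX.exists_lift g hg (Hom.id X)
  have hsq := Hom.isQuasiIso_of_comp_homotopic hg (Hom.isQuasiIso_id X) hs
  obtain ⟨t, ht⟩ := hL.exists_lift s hsq (Hom.id L)
  have e := homologyMap_leftInverse M q hs
  exact ⟨e.injective, fun y => ⟨_, (homologyMap_leftInverse M q ht).injective (e _)⟩⟩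

end DGMod

namespace DGMod

variable {A : CDGA.{u}} {L M N : DGMod A}

/-! ### Stabilization of the tower -/

namespace MinimalBasis

variable (V : L.MinimalBasis)

/-- The retraction of `A ⊗ V` onto `A ⊗ V^{≤ p}`. -/
noncomputable def retrLe (p : ℤ) : L.carrier →ₗ[A.carrier] (V.le p).carrier :=
  (V.retr p).codRestrict (V.leSubmodule p) (V.retr_mem p)

theorem retrLe_mem_gr (p n : ℤ) (x : L.carrier) (hx : x ∈ L.gr n) :
    V.retrLe p x ∈ (V.le p).gr n := by
  change V.retr p x ∈ L.gr n
  rw [← L.proj_same hx, ← proj_retr]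
  exact L.proj_mem _ _

theorem retrLe_coe (p : ℤ) (x : (V.le p).carrier) : V.retrLe p ((V.leι p).toLin x) = x :=
  Subtype.ext (V.retr_of_mem p x.1 x.2)

theorem isLowerSet_deg_le (p : ℤ) : IsLowerSet {α | V.deg α ≤ p} := fun _ _ h hα =>
  (V.deg_mono h).trans hα

/-- The boundary of a map extended from `A ⊗ V^{≤ p}` by zero on the other basis elements. -/
theorem homD_comp_retrLe (p k : ℤ) (f : (V.le p).carrier →ₗ[ℚ] M.carrier)
    (x : (V.le p).carrier) :
    homD L M k (f ∘ₗ (V.retrLe p).restrictScalars ℚ) ((V.leι p).toLin x) =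
      homD (V.le p) M k f x := by
  change M.d (f (V.retrLe p ((V.leι p).toLin x))) -
    k.negOnePow • f (V.retrLe p (L.d ((V.leι p).toLin x))) = M.d (f x) - k.negOnePow • f _
  rw [← (V.leι p).map_d, retrLe_coe, retrLe_coe]

/-- Restriction from `A ⊗ V` to `A ⊗ V^{≤ p}` is bijective on `H^q [-, M]_A` if the cohomology of
`M` vanishes in degrees above `p + q`: the remaining generators have degree at least `p + 1`, so
both the extension of cocycles and that of primitives are unobstructed. -/
theorem homologyMap_leι_bijective {l p q : ℤ} (hM : ∀ n > l, M.toComplex.ExactAt n)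
    (hpq : l ≤ p + q) :
    Function.Bijective (HomologicalComplex.homologyMap (homComplexMap (V.leι p) M) q).hom := by
  have hv : ∀ α, (hα : V.deg α ≤ p) → ∃ x : (V.le p).carrier, (V.leι p).toLin x = V.v α :=
    fun α hα => ⟨⟨V.v α, Submodule.subset_span ⟨α, hα, rfl⟩⟩, rfl⟩
  constructor
  · rw [homologyMap_homComplexMap_injective_iff (V.leι p) M (sub_add_cancel q 1)]
    intro f hf hdf w hw e
    obtain ⟨y, hy, hdy, -⟩ := V.exists_homD_eq (sub_add_cancel q 1) {α | V.deg α ≤ p}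
      (V.isLowerSet_deg_le p) (fun α hα => hM _ (by
        have : ¬V.deg α ≤ p := hα
        lia)) hf hdf
      (comp_mem_homDeg (V.retrLe p) (V.retrLe_mem_gr p) M (q - 1) w hw) (fun α hα => by
        obtain ⟨x, hx⟩ := hv α hα
        rw [← hx, homD_comp_retrLe, e]
        rfl)
    exact ⟨y, hy, hdy⟩
  · refine homologyMap_homComplexMap_surjective_of_lift (V.leι p) M fun f hf hdf => ?_
    have hf' := comp_mem_homDeg (V.retrLe p) (V.retrLe_mem_gr p) M q f hf
    obtain ⟨h, hh, hdh, e⟩ := V.exists_homD_eq (rfl : q + 1 = q + 1) {α | V.deg α ≤ p}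
      (V.isLowerSet_deg_le p) (fun α hα => hM _ (by
        have : ¬V.deg α ≤ p := hα
        lia)) (zero_mem (homDeg L M (q + 1))) (map_zero _) hf' (fun α hα => by
        obtain ⟨x, hx⟩ := hv α hα
        rw [← hx, homD_comp_retrLe, hdf]
        rfl)
    refine ⟨h, hh, hdh, LinearMap.ext fun x => ?_⟩
    refine (eqOn_span_of_mem_homDeg hh hf' ?_ x.2).trans (congrArg f (V.retrLe_coe p x))
    rintro _ ⟨α, hα, rfl⟩
    exact e α hα

/-- The degrees of the generators are bounded below by that of the first generator. -/
theorem exists_le_deg : ∃ k, ∀ α, k ≤ V.deg α := by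
  rcases isEmpty_or_nonempty V.ι with h | h
  · exact ⟨0, fun α => h.elim α⟩
  · obtain ⟨α₀, -, h₀⟩ := (wellFounded_lt (α := V.ι)).has_min Set.univ Set.univ_nonempty
    exact ⟨V.deg α₀, fun α => V.deg_mono (not_lt.1 (h₀ α trivial))⟩

theorem subsingleton_homology_le {k p : ℤ} (hk : ∀ α, k ≤ V.deg α) (hp : p < k) (M : DGMod A)
    (q : ℤ) : Subsingleton ((homComplex (V.le p) M).homology q) := by
  have hbot : V.leSubmodule p = ⊥ := by
    rw [leSubmodule, Submodule.span_eq_bot]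
    rintro _ ⟨α, hα, rfl⟩
    exact absurd ((hk α).trans hα) (not_le.2 hp)
  have hx : ∀ x : (V.le p).carrier, x = 0 := fun x =>
    Subtype.ext ((Submodule.mem_bot _).1 (hbot.le x.2))
  refine subsingleton_of_forall_eq 0 fun c => ?_
  obtain ⟨f, rfl⟩ := (homComplex (V.le p) M).cocycleClass_surjective (rfl : q + 1 = q + 1) c
  have : f = 0 := Subtype.ext (Subtype.ext (LinearMap.ext fun x => by
    rw [hx x]
    exact (map_zero f.1.1).trans (map_zero _).symm))
  rw [this, map_zero]

end MinimalBasis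

end DGMod

/-! ### Strong convergence for a stable tower -/

namespace ExactCouple

variable {C : ExactCouple.{u}}

theorem Cone.F_antitone (T : C.Cone) {s s' : ℤ} (h : s ≤ s') (q : ℤ) : T.F s' q ≤ T.F s q := by
  intro x hx
  have hx : T.η (s' - 1) q x = 0 := hx
  change T.η (s - 1) q x = 0
  rw [← T.i_η (show s - 1 ≤ s' - 1 by lia), hx, map_zero]

theorem Cone.mem_F_succ (T : C.Cone) {p q : ℤ} {x : T.G q} :
    x ∈ T.F (p + 1) q ↔ T.η p q x = 0 := by
  have : ∀ p', p' = p → (T.η p' q x = 0 ↔ T.η p q x = 0) := by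
    rintro _ rfl
    rfl
  exact this _ (add_sub_cancel_right p 1)

/-- If `D` vanishes far to the left and agrees with `G` far to the right, then the infinite cycles
are the elements `z` such that `k z` comes from `G`, the infinite boundaries are the kernel of `k`,
and strong convergence follows: `x ↦ η x` and `z ↦ k z` have the same image in `D`. -/
theorem Cone.convergesStrongly_of_stable (T : C.Cone)
    (h₀ : ∃ p₀, ∀ p < p₀, ∀ q, Subsingleton (C.D p q))
    (h₁ : ∀ q, ∃ p₁, ∀ p ≥ p₁, Function.Bijective (T.η p q)) : T.ConvergesStrongly := by
  obtain ⟨p₀, h₀⟩ := h₀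
  have hF : ∀ q p, Function.Injective (T.η p q) → T.F (p + 1) q = ⊥ := fun q p h =>
    (Submodule.eq_bot_iff _).2 fun x hx => h ((T.mem_F_succ.1 hx).trans (map_zero _).symm)
  refine ⟨fun q x => ⟨p₀, ?_⟩, fun q x hx => ?_, fun q x hx => ?_, fun p q => ?_⟩
  · have := h₀ (p₀ - 1) (by lia) q
    exact Subsingleton.elim (T.η (p₀ - 1) q x) 0
  · obtain ⟨p₁, h₁⟩ := h₁ q
    have := hx (p₁ + 1)
    rwa [hF q p₁ (h₁ p₁ le_rfl).1] at this
  · obtain ⟨p₁, h₁⟩ := h₁ q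
    have hle : ∀ s (n : ℕ), x (s + n) - x s ∈ T.F s q := by
      intro s n
      induction n with
      | zero => simp
      | succ n ih =>
        have := add_mem (T.F_antitone (show s ≤ s + n by lia) q (hx (s + n))) ih
        rw [sub_add_sub_cancel] at this
        rwa [Nat.cast_succ, ← add_assoc]
    refine ⟨x (p₁ + 1), fun s => ?_⟩
    rcases le_total s (p₁ + 1) with h | h
    · obtain ⟨n, hn⟩ := Int.le.dest h
      rw [← hn]
      exact hle s n
    · obtain ⟨n, hn⟩ := Int.le.dest h
      have := hle (p₁ + 1) n
      rw [hF q p₁ (h₁ p₁ le_rfl).1, hn, Submodule.mem_bot, sub_eq_zero] at this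
      rw [this, sub_self]
      exact zero_mem _
  · obtain ⟨p₁, h₁⟩ := h₁ q
    have hZ : ∀ z, z ∈ C.Zinfty p q ↔ ∃ x, T.η p q x = C.k p q z := by
      intro z
      simp only [Zinfty, Submodule.mem_iInf]
      constructor
      · intro hz
        obtain ⟨y, hy⟩ := (mem_Z rfl).1 (hz (max 1 (p₁ + 1 - p)) (le_max_left _ _))
        obtain ⟨x, rfl⟩ := (h₁ (p + max 1 (p₁ + 1 - p) - 1) (by lia)).2 y
        rw [T.i_η] at hy
        exact ⟨x, hy⟩
      · rintro ⟨x, hx⟩ r hr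
        exact (mem_Z rfl).2 ⟨T.η _ q x, by rw [T.i_η, hx]⟩
    have hB : ∀ z, z ∈ C.Binfty p q ↔ C.k p q z = 0 := by
      intro z
      constructor
      · intro hz
        have : C.Binfty p q ≤ LinearMap.ker (C.k p q) :=
          iSup_le fun r => iSup_le fun hr x hx => k_of_mem_B (hr := hr) hx
        exact this hz
      · intro hz
        obtain ⟨y, rfl⟩ := (C.exact_j_k p (sub_add_cancel q 1) z).1 hz
        have hr : 1 ≤ max 1 (p - p₀ + 1) := le_max_left _ _
        refine (le_iSup_of_le (max 1 (p - p₀ + 1)) (le_iSup_of_le hr le_rfl) :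
          C.B _ hr p q ≤ C.Binfty p q) ?_
        have := h₀ (p - max 1 (p - p₀ + 1)) (by lia) (q - 1)
        exact ⟨y, Subsingleton.elim _ _, rfl⟩
    let a : T.F p q →ₗ[ℚ] C.D p q := T.η p q ∘ₗ (T.F p q).subtype
    let b : C.Zinfty p q →ₗ[ℚ] C.D p q := C.k p q ∘ₗ (C.Zinfty p q).subtype
    have ha : (T.F (p + 1) q).submoduleOf (T.F p q) = LinearMap.ker a := by
      ext x
      exact T.mem_F_succ
    have hb : (C.Binfty p q).submoduleOf (C.Zinfty p q) = LinearMap.ker b := by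
      ext z
      exact hB z.1
    have hab : LinearMap.range a = LinearMap.range b := by
      ext y
      constructor
      · rintro ⟨x, rfl⟩
        have hx : C.i (sub_le_self p zero_le_one) q (T.η p q x.1) = 0 := (T.i_η _ q x.1).trans x.2
        obtain ⟨z, hz⟩ := (C.exact_k_i p q _).1 hx
        exact ⟨⟨z, (hZ z).2 ⟨x.1, hz.symm⟩⟩, hz⟩
      · rintro ⟨z, rfl⟩
        obtain ⟨x, hx⟩ := (hZ z.1).1 z.2
        refine ⟨⟨x, ?_⟩, hx⟩
        have := (C.exact_k_i p q).apply_apply_eq_zero z.1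
        rw [← hx, T.i_η] at this
        exact this
    let e := (Submodule.quotEquivOfEq _ _ ha).trans (a.quotKerEquivRange.trans
      ((LinearEquiv.ofEq _ _ hab).trans
        (b.quotKerEquivRange.symm.trans (Submodule.quotEquivOfEq _ _ hb.symm))))
    refine ⟨e, fun x z => ?_⟩
    have he : e (Submodule.Quotient.mk x) = Submodule.Quotient.mk z ↔
        LinearEquiv.ofEq _ _ hab (a.quotKerEquivRange (Submodule.Quotient.mk x)) =
          b.quotKerEquivRange (Submodule.Quotient.mk z) := by
      change Submodule.quotEquivOfEq _ _ hb.symm (b.quotKerEquivRange.symm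
        (LinearEquiv.ofEq _ _ hab (a.quotKerEquivRange (Submodule.Quotient.mk x)))) = _ ↔ _
      rw [← LinearEquiv.eq_symm_apply, LinearEquiv.symm_apply_eq]
      rfl
    rw [he, Subtype.ext_iff]
    exact eq_comm

end ExactCouple

/-! ### Convergence to `Ext` -/

/-- Let `A ⊗ V = L ⟶ N` be a minimal model and let `M` have bounded above cohomology. The exact
couple of the filtration by the `A ⊗ V^{≤ p}` has `E_1^{p,q} = H^q [A ⊗ V^{= p}, M]_A`. The minimal
model is cofibrant, so that it computes `Ext_A(N, -)`; for every cofibrant replacement `R` of `N`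
there is a comparison `g : A ⊗ V ⟶ R` over `N`, up to homotopy, and for every such `g` the spectral
sequence converges strongly to `Ext_A^q(N, M) = H^q [R, M]_A`, filtered by the kernels of the maps
to `H^q [A ⊗ V^{≤ p - 1}, M]_A`. -/
theorem mainTheorem9 (A : CDGA.{u}) (N M L : DGMod.{u} A)
    (hN : N.BoundedBelow) (hM : M.BoundedAbove)
    (V : L.MinimalBasis) (φ : DGMod.Hom L N) (hφ : φ.IsQuasiIso) :
    (∀ p q : ℤ, Nonempty (((V.exactCouple M).spectralSequence.page 1).X (p, q) ≅
      (DGMod.homComplex (V.slice p) M).homology q)) ∧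
    L.Cofibrant ∧
    ∀ R : N.CofibrantReplacement,
      (∃ g : DGMod.Hom L R.obj, (R.map.comp g).Homotopic φ) ∧
      ∀ g : DGMod.Hom L R.obj, (R.map.comp g).Homotopic φ →
        (V.extCone R g M).ConvergesStrongly := by
  refine ⟨fun p q => ⟨(V.exactCouple M).firstPageIso (p, q)⟩, V.cofibrant, fun R =>
    ⟨V.cofibrant.exists_lift R.map R.isQuasiIso φ, fun g hg => ?_⟩⟩
  have hgq := DGMod.Hom.isQuasiIso_of_comp_homotopic R.isQuasiIso hφ hg
  obtain ⟨k, hk⟩ := V.exists_le_deg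
  obtain ⟨l, hl⟩ := hM
  refine ExactCouple.Cone.convergesStrongly_of_stable _
    ⟨k, fun p hp q => V.subsingleton_homology_le hk hp M q⟩ fun q => ⟨l - q, fun p hp => ?_⟩
  have hcomp : HomologicalComplex.homologyMap (DGMod.homComplexMap (g.comp (V.leι p)) M) q =
      HomologicalComplex.homologyMap (DGMod.homComplexMap g M) q ≫
        HomologicalComplex.homologyMap (DGMod.homComplexMap (V.leι p) M) q :=
    HomologicalComplex.homologyMap_comp (DGMod.homComplexMap g M)
      (DGMod.homComplexMap (V.leι p) M) q
  change Function.Bijective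
    (HomologicalComplex.homologyMap (DGMod.homComplexMap (g.comp (V.leι p)) M) q).hom
  rw [hcomp]
  exact (V.homologyMap_leι_bijective hl (by lia)).comp
    (DGMod.homologyMap_bijective_of_cofibrant V.cofibrant R.cofibrant g hgq M q)
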